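/- **Setting.** Let $\mathcal H$ be a real Hilbert space, $m\ge 2$, and let $\sigma_1,\dots,\sigma_m\in\mathbb R$. A set-valued operator $A:\mathcal H\rightrightarrows\mathcal H$ is $\sigma$-monotone if $\langle x-y,u-v\rangle\ge\sigma\|x-y\|^2$ whenever $u\in A(x)$, $v\in A(y)$, and maximal $\sigma$-monotone if moreover no $\sigma$-monotone operator has a graph properly containing that of $A$. For $\gamma>0$ put $J_{\gamma A}=(\mathrm{Id}+\gamma A)^{-1}$, $R_{\gamma A}=2J_{\gamma A}-\mathrm{Id}$, and write $\operatorname{zer}A=\{x:0\in A(x)\}$, $\operatorname{Fix}A=\{x: x\in A(x)\}$. Let $A_1,\dots,A_m:\mathcal H\rightrightarrows\mathcal H$, let $\lambda_1,\dots,\lambda_{m-1}>0$ with $\sum_{i=1}^{m-1}\lambda_i=1$, $\mu\in(0,2)$ and $\lambda>0$. On the Hilbert space $\mathcal H^{m-1}$ with inner product $\sum_{i}\langle x_i,y_i\rangle$ let $\Delta(x)=(x,\dots,x)$, $D=\Delta(\mathcal H)$, let $N_D$ be the normal cone operator of $D$, $\Lambda(\mathbf x)=(\lambda_1x_1,\dots,\lambda_{m-1}x_{m-1})$,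 $F(\mathbf x)=A_1(x_1)\times\cdots\times A_{m-1}(x_{m-1})$, $K(\mathbf x)=\{\Lambda\Delta(v): v\in A_m(x_1)\}$ if $\mathbf x\in D$ and $K(\mathbf x)=\emptyset$ otherwise, and $G=K+N_D$. Let $J^\Lambda_{\lambda B}=(\mathrm{Id}+\lambda\Lambda^{-1}\circ B)^{-1}$ for $B\in\{F,G\}$, $$T(\mathbf x)=\{\mathbf x+\mu(\mathbf y-\mathbf z):\ \mathbf z\in J^\Lambda_{\lambda F}(\mathbf x),\ \mathbf y\in J^\Lambda_{\lambda G}(2\mathbf z-\mathbf x)\},\qquad U(\mathbf x)=J_{\lambda A_m}\Big(\sum_{i=1}^{m-1}\lambda_iR_{\frac{\lambda}{\lambda_i}A_i}(x_i)\Big).$$ A sequence $(\mathbf x^k,\mathbf z^k,\mathbf y^k)_{k\ge0}$ is generated by the algorithm if, for all $k$, $\mathbf z^k\in J^\Lambda_{\lambda F}(\mathbf x^k)$, $\mathbf y^k\in J^\Lambda_{\lambda G}(2\mathbf z^k-\mathbf x^k)$ and $\mathbf x^{k+1}=\mathbf x^k+\mu(\mathbf y^k-\mathbf z^k)$. Let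 $\mathcal I=\{i\in\{1,\dots,m-1\}:\sigma_i\ne0\}$. The step-size problem is to maximize $\bar\lambda\ge0$ over all $\bar\lambda$ and $(\delta_i)_{i\in\mathcal I}$ such that $\sum_{i\in\mathcal I}\delta_i=1$ and, for all $i\in\mathcal I$, $\sigma_i+\sigma_m\delta_i\ge0$ and $1+\frac{\bar\lambda}{\lambda_i}\frac{\sigma_i\sigma_m\delta_i}{\sigma_i+\sigma_m\delta_i}-\frac\mu2\ge0$ (the quotient being required to be defined, i.e. $\sigma_i+\sigma_m\delta_i\neq0$). **Theorem.** Let $A_i$ be maximal $\sigma_i$-monotone for $i=1,\dots,m$, let $\operatorname{zer}(A_1+\cdots+A_m)\ne\emptyset$, and suppose that one of the following holds: * (A) (nonmonotone case) $\sigma_j<0$ for some $j\in\{1,\dots,m\}$, $\sigma_m\ne0$, $\sum_{i=1}^m\sigma_i>0$, and $\bar\lambda^*$ is the optimal value (supremum) of the step-size problem; * (B) (monotone case) $\sigma_i\ge0$ for all $i=1,\dots,m$, and $\bar\lambda^*=+\infty$. Let $\lambda\in(0,\bar\lambda^*)$. Then $J^\Lambda_{\lambda F}$, $J^\Lambda_{\lambda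 G}$, $T$ and $U$ are single-valued with full domain $\mathcal H^{m-1}$. If $(\mathbf x^k,\mathbf z^k,\mathbf y^k)$ is generated by the algorithm from an arbitrary $\mathbf x^0\in\mathcal H^{m-1}$, then there is $\bar{\mathbf x}\in\operatorname{Fix}T$ such that, with $\bar{\mathbf z}=J^\Lambda_{\lambda F}(\bar{\mathbf x})$: 1. $\mathbf x^k\rightharpoonup\bar{\mathbf x}$ weakly and $\bar{\mathbf z}\in\Delta(\operatorname{zer}(\sum_{i=1}^mA_i))$; 2. $\|(\mathrm{Id}-T)\mathbf x^k\|=o(1/\sqrt k)$ as $k\to\infty$; 3. $\|\mathbf y^{k+1}-\mathbf y^k\|=o(1/\sqrt k)$ and $\|\mathbf z^{k+1}-\mathbf z^k\|=o(1/\sqrt k)$ as $k\to\infty$; 4. if (A) holds, or if (B) holds and $\sigma_j>0$ for some $j\in\{1,\dots,m\}$, then $\mathbf z^k\to\bar{\mathbf z}$ and $\mathbf y^k\to\bar{\mathbf z}$ strongly, and $\operatorname{zer}(\sum_{i=1}^mA_i)=\{U(\bar{\mathbf x})\}$; 5. if (B) holds and $\sigma_i=0$ for all $i=1,\dots,m$,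 then $\mathbf z^k\rightharpoonup\bar{\mathbf z}$ and $\mathbf y^k\rightharpoonup\bar{\mathbf z}$ weakly. -/

import Mathlib

open Filter Topology Asymptotics
open scoped Pointwise

noncomputable section

/-! Set-valued operators on a space `E` are functions `E → Set E`. -/

section Operators

variable {E : Type*} [NormedAddCommGroup E] [InnerProductSpace ℝ E]

/-- `A` is `σ`-monotone: `⟪x - y, u - v⟫ ≥ σ ‖x - y‖²` for all `(x, u), (y, v)` in the graph. -/
def IsSigmaMonotone (σ : ℝ) (A : E → Set E) : Prop :=
  ∀ x y u v : E, u ∈ A x → v ∈ A y → σ * ‖x - y‖ ^ 2 ≤ inner ℝ (x - y) (u - v)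

/-- `A` is maximal `σ`-monotone: it is `σ`-monotone and no `σ`-monotone operator has a properly
larger graph (the pointwise order on `E → Set E` is inclusion of graphs). -/
def IsMaximalSigmaMonotone (σ : ℝ) (A : E → Set E) : Prop :=
  Maximal (IsSigmaMonotone σ) A

/-- The zeros of a set-valued operator. -/
def zerosOf (A : E → Set E) : Set E := {x | 0 ∈ A x}

/-- The fixed points of a set-valued operator. -/
def fixOf (A : E → Set E) : Set E := {x | x ∈ A x}

/-- The inverse of a set-valued operator. -/
def invOf (A : E → Set E) : E → Set E := fun y => {x | y ∈ A x}

/-- The pointwise Minkowski sum of a finite family of set-valued operators. -/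
def sumOp {ι : Type*} [Fintype ι] (A : ι → E → Set E) : E → Set E :=
  fun x => {s | ∃ u : ι → E, (∀ i, u i ∈ A i x) ∧ s = ∑ i, u i}

/-- The resolvent `J_{γA} = (Id + γ A)⁻¹`. -/
def resolventOp (γ : ℝ) (A : E → Set E) : E → Set E :=
  invOf fun a => {x | ∃ u ∈ A a, x = a + γ • u}

/-- The reflected resolvent `R_{γA} = 2 J_{γA} - Id`. -/
def reflectedResolventOp (γ : ℝ) (A : E → Set E) : E → Set E :=
  fun x => {r | ∃ a ∈ resolventOp γ A x, r = (2 : ℝ) • a - x}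

/-- The `L`-warped resolvent `(Id + γ L⁻¹ ∘ A)⁻¹`. For an invertible `L` the set `L⁻¹ (A a)` is the
preimage of `A a` under `L`, which is how it is written here. -/
def warpedResolventOp (L : E →ₗ[ℝ] E) (γ : ℝ) (A : E → Set E) : E → Set E :=
  invOf fun a => {x | ∃ v ∈ L ⁻¹' (A a), x = a + γ • v}

/-- The normal cone operator of a convex set `C`. -/
def normalConeOp (C : Set E) : E → Set E :=
  fun x => {p | x ∈ C ∧ ∀ y ∈ C, inner ℝ p (y - x) ≤ 0}

/-- Weak convergence of a sequence. -/
def WeaklyConverges (x : ℕ → E) (a : E) : Prop :=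
  Tendsto (fun k => toWeakSpace ℝ E (x k)) atTop (𝓝 (toWeakSpace ℝ E a))

end Operators

section ProductSpace

/-- The Hilbert space `H^n` with inner product `∑ i, ⟪x i, y i⟫`. -/
abbrev ProdSpace (H : Type*) (n : ℕ) : Type _ := PiLp 2 (fun _ : Fin n => H)

variable {H : Type*} [NormedAddCommGroup H] [InnerProductSpace ℝ H] {n : ℕ}

/-- The embedding `x ↦ (x, …, x)`. -/
def diagEmb (H : Type*) (n : ℕ) : H → ProdSpace H n := fun x => WithLp.toLp 2 fun _ => x

/-- The diagonal subspace `{x | x 1 = ⋯ = x n}`. -/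
def diagSet (H : Type*) (n : ℕ) : Set (ProdSpace H n) := {x | ∀ i j, x i = x j}

/-- The diagonal operator `(x 1, …, x n) ↦ (w 1 • x 1, …, w n • x n)`. -/
def weightMap (H : Type*) [NormedAddCommGroup H] [InnerProductSpace ℝ H] {n : ℕ} (w : Fin n → ℝ) :
    ProdSpace H n →ₗ[ℝ] ProdSpace H n where
  toFun x := WithLp.toLp 2 fun i => w i • x i
  map_add' x y := by ext i; simp
  map_smul' c x := by ext i; simp [smul_smul, mul_comm]

/-! The operators `A 1, …, A m` with `m = n + 1` are indexed by `Fin (n + 1)`: those with index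
`Fin.castSucc i`, `i : Fin n`, are the first `m - 1` ones, and `A (Fin.last n)` is the last one. -/

/-- `F (x) = A 1 (x 1) × ⋯ × A (m - 1) (x (m - 1))`. -/
def opF (A : Fin (n + 1) → H → Set H) : ProdSpace H n → Set (ProdSpace H n) :=
  fun x => {u | ∀ i : Fin n, u i ∈ A i.castSucc (x i)}

/-- `K (x) = {(w 1 • v, …, w (m - 1) • v) | v ∈ A m (ξ)}` if `x = (ξ, …, ξ)`, and `K (x) = ∅` if
`x` is not on the diagonal. -/
def opK (A : Fin (n + 1) → H → Set H) (w : Fin n → ℝ) : ProdSpace H n → Set (ProdSpace H n) :=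
  fun x => {u | ∃ ξ : H, x = diagEmb H n ξ ∧
    ∃ v ∈ A (Fin.last n) ξ, u = weightMap H w (diagEmb H n v)}

/-- `G = K + N_D` with `D` the diagonal. -/
def opG (A : Fin (n + 1) → H → Set H) (w : Fin n → ℝ) : ProdSpace H n → Set (ProdSpace H n) :=
  fun x => opK A w x + normalConeOp (diagSet H n) x

/-- The warped resolvent of `F`. -/
def resF (A : Fin (n + 1) → H → Set H) (w : Fin n → ℝ) (lam : ℝ) :
    ProdSpace H n → Set (ProdSpace H n) :=
  warpedResolventOp (weightMap H w) lam (opF A)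

/-- The warped resolvent of `G`. -/
def resG (A : Fin (n + 1) → H → Set H) (w : Fin n → ℝ) (lam : ℝ) :
    ProdSpace H n → Set (ProdSpace H n) :=
  warpedResolventOp (weightMap H w) lam (opG A w)

/-- The (relaxed, weighted) Douglas-Rachford operator. -/
def drOp (A : Fin (n + 1) → H → Set H) (w : Fin n → ℝ) (lam μ : ℝ) :
    ProdSpace H n → Set (ProdSpace H n) :=
  fun x => {t | ∃ z ∈ resF A w lam x, ∃ y ∈ resG A w lam ((2 : ℝ) • z - x), t = x + μ • (y - z)}

/-- `(x, z, y)` is a sequence generated by the Douglas-Rachford algorithm. -/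
def IsDRSequence (A : Fin (n + 1) → H → Set H) (w : Fin n → ℝ) (lam μ : ℝ)
    (x z y : ℕ → ProdSpace H n) : Prop :=
  ∀ k, z k ∈ resF A w lam (x k) ∧ y k ∈ resG A w lam ((2 : ℝ) • z k - x k) ∧
    x (k + 1) = x k + μ • (y k - z k)

/-- `U (x) = J_{λ A m} (∑ i, w i • R_{(λ / w i) A i} (x i))`. -/
def opU (A : Fin (n + 1) → H → Set H) (w : Fin n → ℝ) (lam : ℝ) : ProdSpace H n → Set H :=
  fun x => {u | ∃ r : Fin n → H,
    (∀ i, r i ∈ reflectedResolventOp (lam / w i) (A i.castSucc) (x i)) ∧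
    u ∈ resolventOp lam (A (Fin.last n)) (∑ i, w i • r i)}

end ProductSpace

section StepSize

variable {n : ℕ}

/-- The indices `i ≤ m - 1` with `σ i ≠ 0`. -/
abbrev NonzeroIdx (σ : Fin (n + 1) → ℝ) : Type := {i : Fin n // σ i.castSucc ≠ 0}

/-- The feasible pairs `(δ, t)` of the step-size problem: `t ≥ 0`, `∑ i, δ i = 1`,
`σ i + σ m δ i ≥ 0` and `1 + (t / w i) (σ i σ m δ i / (σ i + σ m δ i)) - μ / 2 ≥ 0` for all indices
`i ≤ m - 1` with `σ i ≠ 0`, where the quotient is required to be defined. -/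
def stepFeasible (σ : Fin (n + 1) → ℝ) (w : Fin n → ℝ) (μ : ℝ) : Set ((NonzeroIdx σ → ℝ) × ℝ) :=
  {p | 0 ≤ p.2 ∧ ∑ i, p.1 i = 1 ∧ ∀ i : NonzeroIdx σ,
    0 ≤ σ i.1.castSucc + σ (Fin.last n) * p.1 i ∧
    σ i.1.castSucc + σ (Fin.last n) * p.1 i ≠ 0 ∧
    0 ≤ 1 + p.2 / w i.1 * (σ i.1.castSucc * σ (Fin.last n) * p.1 i /
      (σ i.1.castSucc + σ (Fin.last n) * p.1 i)) - μ / 2}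

/-- The optimal value of the step-size problem, as an extended real number. -/
def optimalStep (σ : Fin (n + 1) → ℝ) (w : Fin n → ℝ) (μ : ℝ) : EReal :=
  sSup ((fun p => (p.2 : EReal)) '' stepFeasible σ w μ)

/-- Nonmonotone case. -/
def NonmonotoneCase (σ : Fin (n + 1) → ℝ) : Prop :=
  (∃ j, σ j < 0) ∧ σ (Fin.last n) ≠ 0 ∧ 0 < ∑ i, σ i

/-- Monotone case. -/
def MonotoneCase (σ : Fin (n + 1) → ℝ) : Prop := ∀ i, 0 ≤ σ i

end StepSize

end

noncomputable section

/-! ### Minty's theorem and resolvents of maximal `σ`-monotone operators -/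

section Resolvents

variable {E : Type*} [NormedAddCommGroup E] [InnerProductSpace ℝ E]

/-! The warped resolvent of `F` acts componentwise through the resolvents of `A i` with parameter
`lam / w i`. The normal cone of the diagonal is its orthogonal complement, so the warped resolvent
of `G` applies the resolvent of the last operator to the weighted average and copies the result. One
step is thus governed by the points `z i` and one common point `ξ`.

For two steps, an exact identity gives the decrease of the weighted squared distance
(`sum_mul_norm_add_smul_sub_sq`). By `σ`-monotonicity this decrease is at least `μ` times `(2 - μ) ∑
w i ‖ξ - z i‖² + 2 lam (σ m ‖ξ‖² + ∑ σ i ‖z i‖²)`, where `ξ` and `z i` now denote differences.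
Splitting `σ m = ∑ α i` decouples this form into pairs, and `α ‖a‖² + β ‖b‖² ≥ αβ/(α+β) ‖a - b‖²`
shows that a step size below the optimal value makes each nontrivial pair coercive
(`exists_splitting`, `exists_pos_mul_le_sum_quadratic`). The same inequalities give `1 + γσ > 0` for
all resolvents, which are then single-valued with full domain by Minty's theorem.

Hence the step is averaged in the weighted norm. Opial's lemma yields weak convergence, and a
monotone square-summable residual is `o(1/√k)`. If some `α i + σ i > 0`, the form also controls
`‖ξ‖²`, which gives the unique zero and strong convergence of the shadows. If all moduli vanish, the
weak limit of the shadows is identified by a demiclosedness principle for the whole family `A`. -/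

theorem exists_forall_le_of_isClosed_of_convex [CompleteSpace E] {C : Set (E × ℝ)}
    (hne : C.Nonempty) (hcl : IsClosed C) (hconv : Convex ℝ C) (b : ℝ)
    (hb : ∀ p ∈ C, b ≤ p.2 + ‖p.1‖ ^ 2 / 2) :
    ∃ p₀ ∈ C, ∀ p ∈ C, p₀.2 + ‖p₀.1‖ ^ 2 ≤ p.2 + inner ℝ p₀.1 p.1 := by
  set φ : E × ℝ → ℝ := fun p => p.2 + ‖p.1‖ ^ 2 / 2 with hφ
  set m := sInf (φ '' C)
  have hbdd : BddBelow (φ '' C) := ⟨b, by rintro _ ⟨p, hp, rfl⟩; exact hb p hp⟩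
  have hm : ∀ p ∈ C, m ≤ φ p := fun p hp => csInf_le hbdd ⟨p, hp, rfl⟩
  have hseq : ∀ k : ℕ, ∃ p ∈ C, φ p < m + 1 / ((k : ℝ) + 1) := fun k => by
    obtain ⟨_, ⟨p, hp, rfl⟩, h⟩ := exists_lt_of_csInf_lt (hne.image φ)
      (lt_add_of_pos_right m (Nat.one_div_pos_of_nat (n := k) (α := ℝ)))
    exact ⟨p, hp, h⟩
  choose p hpC hp using hseq
  -- `φ` is strongly convex in the first variable: evaluating it at midpoints shows that a
  -- minimizing sequence is Cauchy there. The second coordinate then converges because `φ (p k)`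
  -- does.
  have hmid : ∀ k l, ‖(p k).1 - (p l).1‖ ^ 2 ≤ 4 * (1 / ((k : ℝ) + 1) + 1 / ((l : ℝ) + 1)) := by
    intro k l
    have h1 := hm _ (hconv (hpC k) (hpC l) (by norm_num : (0 : ℝ) ≤ 1 / 2)
      (by norm_num : (0 : ℝ) ≤ 1 / 2) (by norm_num))
    have h2 := hp k
    have h3 := hp l
    simp only [hφ, Prod.fst_add, Prod.snd_add, Prod.smul_fst, Prod.smul_snd, smul_eq_mul] at h1 h2 h3
    have h4 := parallelogram_law_with_norm ℝ (p k).1 (p l).1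
    have h5 : ‖(1 / 2 : ℝ) • (p k).1 + (1 / 2 : ℝ) • (p l).1‖ = ‖(p k).1 + (p l).1‖ / 2 := by
      rw [← smul_add, norm_smul]; norm_num; ring
    rw [h5] at h1
    nlinarith
  have hinv := tendsto_one_div_add_atTop_nhds_zero_nat (𝕜 := ℝ)
  have hcau : CauchySeq fun k => (p k).1 := by
    refine cauchySeq_of_le_tendsto_0 (fun N : ℕ => √(8 * (1 / ((N : ℝ) + 1)))) (fun k l N hk hl => ?_) ?_
    · rw [dist_eq_norm]
      apply Real.le_sqrt_of_sq_le
      have hk' := Nat.one_div_le_one_div (α := ℝ) hk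
      have hl' := Nat.one_div_le_one_div (α := ℝ) hl
      linarith [hmid k l]
    · have := (hinv.const_mul 8).sqrt
      simpa using this
  obtain ⟨x₀, hx₀⟩ := cauchySeq_tendsto_of_complete hcau
  have hφlim : Tendsto (fun k => φ (p k)) atTop (𝓝 m) := by
    refine tendsto_of_tendsto_of_tendsto_of_le_of_le tendsto_const_nhds
      (by simpa using hinv.const_add m) (fun k => hm _ (hpC k)) (fun k => (hp k).le)
  have ht : Tendsto (fun k => (p k).2) atTop (𝓝 (m - ‖x₀‖ ^ 2 / 2)) := by
    have := hφlim.sub ((hx₀.norm.pow 2).div_const 2)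
    refine this.congr fun k => ?_
    simp [hφ]
  have hmem : (x₀, m - ‖x₀‖ ^ 2 / 2) ∈ C :=
    hcl.mem_of_tendsto (hx₀.prodMk_nhds ht) (Eventually.of_forall hpC)
  refine ⟨_, hmem, fun q hq => ?_⟩
  -- First-order optimality: compare the minimizer with the point at parameter `s` on the segment to
  -- `q`, divide by `s`, then let `s` tend to `0`.
  have key : ∀ s ∈ Set.Ioc (0 : ℝ) 1,
      0 ≤ q.2 - (m - ‖x₀‖ ^ 2 / 2) + inner ℝ x₀ (q.1 - x₀) + s * (‖q.1 - x₀‖ ^ 2 / 2) := by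
    intro s hs
    have h1 := hm _ (hconv hmem hq (sub_nonneg.2 hs.2) hs.1.le (by ring))
    simp only [hφ, Prod.fst_add, Prod.snd_add, Prod.smul_fst, Prod.smul_snd, smul_eq_mul] at h1
    have h2 : (1 - s) • x₀ + s • q.1 = x₀ + s • (q.1 - x₀) := by module
    rw [h2, norm_add_sq_real, norm_smul, inner_smul_right, Real.norm_of_nonneg hs.1.le] at h1
    have h3 : 0 ≤ s * (q.2 - (m - ‖x₀‖ ^ 2 / 2) + inner ℝ x₀ (q.1 - x₀)
        + s * (‖q.1 - x₀‖ ^ 2 / 2)) := by linarith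
    exact nonneg_of_mul_nonneg_right h3 hs.1
  have hlim : Tendsto (fun s : ℝ => q.2 - (m - ‖x₀‖ ^ 2 / 2) + inner ℝ x₀ (q.1 - x₀)
      + s * (‖q.1 - x₀‖ ^ 2 / 2)) (𝓝[>] 0)
      (𝓝 (q.2 - (m - ‖x₀‖ ^ 2 / 2) + inner ℝ x₀ (q.1 - x₀) + 0 * (‖q.1 - x₀‖ ^ 2 / 2))) :=
    ((continuous_const.add (continuous_id.mul continuous_const)).tendsto 0).mono_left
      nhdsWithin_le_nhds
  have h0 := ge_of_tendsto hlim (by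
    filter_upwards [Ioc_mem_nhdsGT (zero_lt_one (α := ℝ))] with s hs using key s hs)
  rw [inner_sub_right, real_inner_self_eq_norm_sq] at h0
  simp only
  linarith

/-- Minty's theorem for a graph: a maximal monotone relation contains some pair `(a, -a)`. -/
theorem exists_neg_mem_of_maximal_monotone [CompleteSpace E] (G : Set (E × E))
    (hmono : ∀ p ∈ G, ∀ q ∈ G, 0 ≤ (inner ℝ (p.1 - q.1) (p.2 - q.2) : ℝ))
    (hmax : ∀ p, (∀ q ∈ G, 0 ≤ (inner ℝ (p.1 - q.1) (p.2 - q.2) : ℝ)) → p ∈ G) :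
    ∃ a, (a, -a) ∈ G := by
  -- The epigraph of the Fitzpatrick function of `G`. By `hge` this function dominates the duality
  -- pairing, so adding `‖·‖² / 2` keeps it nonnegative, and a minimizer exists.
  set C : Set (WithLp 2 (E × E) × ℝ) :=
    {P | ∀ q ∈ G, (inner ℝ P.1.fst q.2 + inner ℝ q.1 P.1.snd - inner ℝ q.1 q.2 : ℝ) ≤ P.2} with hC
  have hself : ∀ p ∈ G, (WithLp.toLp 2 p, (inner ℝ p.1 p.2 : ℝ)) ∈ C := by
    intro p hp q hq
    have := hmono p hp q hq
    simp only [inner_sub_left, inner_sub_right] at this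
    simp only
    change (inner ℝ p.1 q.2 + inner ℝ q.1 p.2 - inner ℝ q.1 q.2 : ℝ) ≤ _
    linarith
  have hge : ∀ P ∈ C, (inner ℝ P.1.fst P.1.snd : ℝ) ≤ P.2 := by
    intro P hP
    by_contra! hlt
    have hPG : (P.1.fst, P.1.snd) ∈ G := hmax _ fun q hq => by
      have := hP q hq
      simp only [inner_sub_left, inner_sub_right]
      linarith
    have := hP _ hPG
    simp only at this
    linarith
  obtain ⟨p, hp⟩ : G.Nonempty := by
    by_contra h
    rw [Set.not_nonempty_iff_eq_empty] at h
    have := hmax (0, 0) (by simp [h])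
    simp [h] at this
  have hcl : IsClosed C := by
    simp only [hC, Set.ofPred_forall]
    refine isClosed_iInter fun q => isClosed_iInter fun _ => isClosed_le ?_ continuous_snd
    fun_prop
  have hconv : Convex ℝ C := by
    intro P hP Q hQ s t hs ht hst q hq
    have h1 := mul_le_mul_of_nonneg_left (hP q hq) hs
    have h2 := mul_le_mul_of_nonneg_left (hQ q hq) ht
    simp only [Prod.fst_add, Prod.snd_add, Prod.smul_fst, Prod.smul_snd, smul_eq_mul,
      WithLp.add_fst, WithLp.add_snd, WithLp.smul_fst, WithLp.smul_snd, inner_add_left,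
      inner_add_right, inner_smul_left, inner_smul_right, RCLike.conj_to_real]
    have h3 : (inner ℝ q.1 q.2 : ℝ) = s * inner ℝ q.1 q.2 + t * inner ℝ q.1 q.2 := by
      rw [← add_mul, hst, one_mul]
    rw [h3]
    linarith
  have hnorm : ∀ P : WithLp 2 (E × E), ‖P‖ ^ 2 = ‖P.fst‖ ^ 2 + ‖P.snd‖ ^ 2 := fun P => by
    rw [WithLp.prod_norm_sq_eq_of_L2]
  obtain ⟨P, hPC, hP⟩ := exists_forall_le_of_isClosed_of_convex ⟨_, hself p hp⟩ hcl hconv 0 (by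
    intro P hP
    have h1 := hge P hP
    have h2 := norm_add_sq_real P.1.fst P.1.snd
    rw [hnorm]
    nlinarith [sq_nonneg ‖P.1.fst + P.1.snd‖])
  have hPge := hge P hPC
  -- For the minimizer `(x, u)`, the optimality condition tested on the graph says that `(-u, -x)`
  -- is monotonically related to `G`, hence lies in `G`. Testing with this very pair forces `x + u =
  -- 0`.
  have key : ∀ q ∈ G, ‖P.1.fst + P.1.snd‖ ^ 2 ≤
      (inner ℝ (-P.1.snd - q.1) (-P.1.fst - q.2) : ℝ) := by
    intro q hq
    have h1 := hP _ (hself q hq)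
    rw [WithLp.prod_inner_apply, hnorm] at h1
    change _ ≤ (inner ℝ q.1 q.2 + (inner ℝ P.1.fst q.1 + inner ℝ P.1.snd q.2) : ℝ) at h1
    rw [norm_add_sq_real]
    simp only [inner_sub_left, inner_sub_right, inner_neg_left, inner_neg_right]
    rw [real_inner_comm P.1.fst P.1.snd, real_inner_comm P.1.fst q.1]
    linarith
  have hmem : (-P.1.snd, -P.1.fst) ∈ G := hmax _ fun q hq => (sq_nonneg _).trans (key q hq)
  have h0 := key _ hmem
  simp only [sub_self, inner_zero_left] at h0
  have h1 : P.1.fst + P.1.snd = 0 := by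
    rw [← norm_eq_zero]
    exact pow_eq_zero_iff two_ne_zero |>.1 (le_antisymm h0 (sq_nonneg _))
  refine ⟨P.1.fst, ?_⟩
  rwa [← eq_neg_of_add_eq_zero_left h1] at hmem

theorem IsMaximalSigmaMonotone.mem_of_forall {σ : ℝ} {A : E → Set E}
    (hA : IsMaximalSigmaMonotone σ A) {x u : E}
    (h : ∀ a, ∀ v ∈ A a, σ * ‖x - a‖ ^ 2 ≤ inner ℝ (x - a) (u - v)) : u ∈ A x := by
  have hB : IsSigmaMonotone σ (fun a => A a ∪ {v | a = x ∧ v = u}) := by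
    rintro a b v v' (hv | ⟨rfl, rfl⟩) (hv' | ⟨rfl, rfl⟩)
    · exact hA.prop a b v v' hv hv'
    · rw [← neg_sub b a, norm_neg, ← neg_sub v' v, inner_neg_neg]
      exact h a v hv
    · exact h b v' hv'
    · simp
  exact hA.le_of_ge hB (fun a => Set.subset_union_left) x (Or.inr ⟨rfl, rfl⟩)

/-- Minty's theorem: the resolvent of a maximal `σ`-monotone operator has full domain. -/
theorem IsMaximalSigmaMonotone.exists_mem_resolventOp [CompleteSpace E] {σ γ : ℝ} {A : E → Set E}
    (hA : IsMaximalSigmaMonotone σ A) (hγ : 0 < γ) (hσ : 0 < 1 + γ * σ) (x : E) :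
    ∃ a, a ∈ resolventOp γ A x := by
  set c := 1 + γ * σ with hc
  have aux : ∀ p q : E × E, (inner ℝ (p.1 - q.1)
      ((σ • p.1 + γ⁻¹ • (c • p.2 + x)) - (σ • q.1 + γ⁻¹ • (c • q.2 + x))) : ℝ) =
      σ * ‖p.1 - q.1‖ ^ 2 + γ⁻¹ * c * inner ℝ (p.1 - q.1) (p.2 - q.2) := by
    intro p q
    rw [show (σ • p.1 + γ⁻¹ • (c • p.2 + x)) - (σ • q.1 + γ⁻¹ • (c • q.2 + x)) =
      σ • (p.1 - q.1) + (γ⁻¹ * c) • (p.2 - q.2) by module]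
    rw [inner_add_right, inner_smul_right, inner_smul_right, real_inner_self_eq_norm_sq]
  have hpos : 0 < γ⁻¹ * c := by positivity
  -- This affine change of the second variable turns `σ`-monotonicity into monotonicity, and it
  -- sends `(a, -a)` to `(a, γ⁻¹ • (x - a))`, because `c = 1 + γ * σ`.
  obtain ⟨a, ha⟩ := exists_neg_mem_of_maximal_monotone
    {p : E × E | σ • p.1 + γ⁻¹ • (c • p.2 + x) ∈ A p.1} (fun p hp q hq => by
      have := hA.prop _ _ _ _ hp hq
      rw [aux] at this
      exact nonneg_of_mul_nonneg_right (by linarith) hpos) (fun p hp => by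
      refine hA.mem_of_forall fun b v hv => ?_
      have hq : σ • b + γ⁻¹ • (c • (c⁻¹ • (γ • (v - σ • b) - x)) + x) = v := by
        rw [smul_inv_smul₀ hσ.ne', sub_add_cancel, inv_smul_smul₀ hγ.ne']; abel
      have h1 := hp (b, c⁻¹ • (γ • (v - σ • b) - x)) (by simpa only [Set.mem_ofPred_eq, hq] using hv)
      have h2 := aux p (b, c⁻¹ • (γ • (v - σ • b) - x))
      simp only [hq] at h2
      rw [h2]
      have := mul_nonneg hpos.le h1
      simp only at this
      linarith)
  refine ⟨a, _, ha, ?_⟩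
  rw [smul_add, smul_inv_smul₀ hγ.ne', hc]
  module

theorem IsSigmaMonotone.inner_le_of_mem_resolventOp {σ γ : ℝ} {A : E → Set E}
    (hA : IsSigmaMonotone σ A) (hγ : 0 < γ) {x y a b : E}
    (ha : a ∈ resolventOp γ A x) (hb : b ∈ resolventOp γ A y) :
    (1 + γ * σ) * ‖a - b‖ ^ 2 ≤ inner ℝ (a - b) (x - y) := by
  obtain ⟨u, hu, rfl⟩ := ha
  obtain ⟨v, hv, rfl⟩ := hb
  have h := mul_le_mul_of_nonneg_left (hA _ _ _ _ hu hv) hγ.le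
  rw [show a + γ • u - (b + γ • v) = (a - b) + γ • (u - v) by module, inner_add_right,
    inner_smul_right, real_inner_self_eq_norm_sq]
  linarith

theorem IsSigmaMonotone.norm_sub_le_of_mem_resolventOp {σ γ : ℝ} {A : E → Set E}
    (hA : IsSigmaMonotone σ A) (hγ : 0 < γ) (hσ : 0 < 1 + γ * σ) {x y a b : E}
    (ha : a ∈ resolventOp γ A x) (hb : b ∈ resolventOp γ A y) :
    ‖a - b‖ ≤ (1 + γ * σ)⁻¹ * ‖x - y‖ := by
  have h := (hA.inner_le_of_mem_resolventOp hγ ha hb).trans (real_inner_le_norm _ _)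
  rw [inv_mul_eq_div, le_div_iff₀ hσ]
  rcases (norm_nonneg (a - b)).eq_or_lt with h0 | h0
  · rw [← h0]; simp
  · nlinarith

/-- The resolvent of a maximal `σ`-monotone operator is single-valued with full domain. -/
theorem IsMaximalSigmaMonotone.exists_resolventOp_eq [CompleteSpace E] {σ γ : ℝ} {A : E → Set E}
    (hA : IsMaximalSigmaMonotone σ A) (hγ : 0 < γ) (hσ : 0 < 1 + γ * σ) :
    ∃ J : E → E, ∀ x, resolventOp γ A x = {J x} := by
  choose J hJ using hA.exists_mem_resolventOp hγ hσ
  refine ⟨J, fun x => Set.eq_singleton_iff_unique_mem.2 ⟨hJ x, fun a ha => ?_⟩⟩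
  have := hA.prop.norm_sub_le_of_mem_resolventOp hγ hσ ha (hJ x)
  rw [sub_self, norm_zero, mul_zero] at this
  exact sub_eq_zero.1 (norm_le_zero_iff.1 this)

end Resolvents

/-! ### Weak limits, Opial's lemma and averaged iterations -/

section WeakConvergence

variable {E : Type*} [NormedAddCommGroup E] [InnerProductSpace ℝ E]

theorem tendsto_inner_of_tendsto_sub {ι : Type*} {l : Filter ι} {x y : ι → E} {a : E}
    (hx : ∀ v, Tendsto (fun i => (inner ℝ (x i) v : ℝ)) l (𝓝 (inner ℝ a v)))
    (hxy : Tendsto (fun i => y i - x i) l (𝓝 0)) (v : E) :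
    Tendsto (fun i => (inner ℝ (y i) v : ℝ)) l (𝓝 (inner ℝ a v)) := by
  have h := (hx v).add (hxy.inner (𝕜 := ℝ) (tendsto_const_nhds (x := v)))
  simpa [← inner_add_left] using h

/-- Demiclosedness principle for nonexpansive maps. -/
theorem eq_of_tendsto_inner_of_nonexpansive {ι : Type*} {l : Filter ι} [l.NeBot] {S : E → E}
    (hS : ∀ x y, ‖S x - S y‖ ≤ ‖x - y‖) {x : ι → E} {a : E} {M : ℝ} (hM : ∀ i, ‖x i‖ ≤ M)
    (hx : ∀ v, Tendsto (fun i => (inner ℝ (x i) v : ℝ)) l (𝓝 (inner ℝ a v)))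
    (hres : Tendsto (fun i => ‖x i - S (x i)‖) l (𝓝 0)) : S a = a := by
  -- Expand `‖x i - S a‖²` around `a` and bound it by nonexpansiveness. The inner product vanishes
  -- in the weak limit, which leaves `‖a - S a‖² ≤ 0`.
  have hle : ∀ i, 2 * inner ℝ (x i - a) (a - S a) + ‖a - S a‖ ^ 2 ≤
      2 * (M + ‖a‖) * ‖x i - S (x i)‖ + ‖x i - S (x i)‖ ^ 2 := by
    intro i
    have h1 : ‖x i - S a‖ ≤ ‖x i - S (x i)‖ + ‖x i - a‖ := by
      calc ‖x i - S a‖ = ‖(x i - S (x i)) + (S (x i) - S a)‖ := by congr 1; abel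
        _ ≤ _ := (norm_add_le _ _).trans (add_le_add_right (hS _ _) _)
    have h2 : ‖x i - S a‖ ^ 2 =
        ‖x i - a‖ ^ 2 + 2 * inner ℝ (x i - a) (a - S a) + ‖a - S a‖ ^ 2 := by
      rw [← norm_add_sq_real]; congr 2; abel
    have h3 : ‖x i - a‖ ≤ M + ‖a‖ := (norm_sub_le _ _).trans (add_le_add_left (hM i) _)
    have h4 := pow_le_pow_left₀ (norm_nonneg _) h1 2
    have h5 := mul_le_mul_of_nonneg_right h3 (norm_nonneg (x i - S (x i)))
    nlinarith
  have hlim : Tendsto (fun i => 2 * (inner ℝ (x i - a) (a - S a) : ℝ) + ‖a - S a‖ ^ 2) l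
      (𝓝 (2 * 0 + ‖a - S a‖ ^ 2)) := by
    refine Tendsto.add (Tendsto.const_mul _ ?_) tendsto_const_nhds
    have := (hx (a - S a)).sub_const (inner ℝ a (a - S a))
    simpa [inner_sub_left] using this
  have hlim' : Tendsto (fun i => 2 * (M + ‖a‖) * ‖x i - S (x i)‖ + ‖x i - S (x i)‖ ^ 2) l
      (𝓝 (2 * (M + ‖a‖) * 0 + 0 ^ 2)) := (hres.const_mul _).add (hres.pow 2)
  have h := le_of_tendsto_of_tendsto' hlim hlim' hle
  have h0 : ‖a - S a‖ ^ 2 ≤ 0 := by linarith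
  have h1 : ‖a - S a‖ = 0 := pow_eq_zero_iff two_ne_zero |>.1 (le_antisymm h0 (sq_nonneg _))
  exact (sub_eq_zero.1 (norm_eq_zero.1 h1)).symm

variable [CompleteSpace E]

theorem weaklyConverges_iff_forall_inner {x : ℕ → E} {a : E} :
    WeaklyConverges x a ↔
      ∀ v, Tendsto (fun k => (inner ℝ (x k) v : ℝ)) atTop (𝓝 (inner ℝ a v)) := by
  have hinj : Function.Injective (topDualPairing ℝ E).flip := by
    intro x y hxy
    refine ext_inner_left ℝ fun v => ?_
    exact DFunLike.congr_fun hxy (InnerProductSpace.toDual ℝ E v)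
  have h := WeakBilin.tendsto_iff_forall_eval_tendsto (topDualPairing ℝ E).flip hinj
    (l := atTop) (f := x) (x := a)
  refine Iff.trans h ⟨fun h v => ?_, fun h f => ?_⟩
  · simpa [real_inner_comm] using h (InnerProductSpace.toDual ℝ E v)
  · have h1 := h ((InnerProductSpace.toDual ℝ E).symm f)
    have h2 : ∀ y : E, (inner ℝ y ((InnerProductSpace.toDual ℝ E).symm f) : ℝ) = f y := fun y => by
      rw [real_inner_comm, InnerProductSpace.toDual_symm_apply]
    simp only [h2] at h1
    exact h1

/-- A bounded family has a weak limit along every ultrafilter. -/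
theorem exists_tendsto_inner_of_bounded {ι : Type*} (U : Ultrafilter ι) {x : ι → E} {M : ℝ}
    (hM : ∀ i, ‖x i‖ ≤ M) :
    ∃ a, ∀ v, Tendsto (fun i => (inner ℝ (x i) v : ℝ)) U (𝓝 (inner ℝ a v)) := by
  set D : E → WeakDual ℝ E := fun y => StrongDual.toWeakDual (InnerProductSpace.toDual ℝ E y)
  -- Banach–Alaoglu, transported by the Riesz isomorphism.
  have hc := WeakDual.isCompact_closedBall (𝕜 := ℝ) (E := E) 0 M
  obtain ⟨f, -, hf⟩ := isCompact_iff_ultrafilter_le_nhds.1 hc (U.map fun i => D (x i)) (by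
    rw [le_principal_iff]
    refine Filter.mem_map.2 (Filter.univ_mem' fun i => ?_)
    simpa [D] using hM i)
  refine ⟨(InnerProductSpace.toDual ℝ E).symm (WeakDual.toStrongDual f), fun v => ?_⟩
  rw [InnerProductSpace.toDual_symm_apply]
  exact ((WeakDual.eval_continuous v).tendsto f).comp hf

/-- Opial's lemma. -/
theorem exists_tendsto_inner_of_opial {x : ℕ → E} {F : Set E} (hF : F.Nonempty)
    (hdist : ∀ p ∈ F, ∃ d, Tendsto (fun k => ‖x k - p‖) atTop (𝓝 d))
    (hcluster : ∀ (U : Ultrafilter ℕ) (a : E), (U : Filter ℕ) ≤ atTop →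
      (∀ v, Tendsto (fun k => (inner ℝ (x k) v : ℝ)) U (𝓝 (inner ℝ a v))) → a ∈ F) :
    ∃ a ∈ F, ∀ v, Tendsto (fun k => (inner ℝ (x k) v : ℝ)) atTop (𝓝 (inner ℝ a v)) := by
  obtain ⟨M, hM⟩ : ∃ M, ∀ k, ‖x k‖ ≤ M := by
    obtain ⟨p, hp⟩ := hF
    obtain ⟨d, hd⟩ := hdist p hp
    obtain ⟨M, hM⟩ := hd.bddAbove_range
    refine ⟨M + ‖p‖, fun k => ?_⟩
    calc ‖x k‖ = ‖(x k - p) + p‖ := by rw [sub_add_cancel]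
      _ ≤ _ := (norm_add_le _ _).trans (add_le_add_left (hM ⟨k, rfl⟩) _)
  have huniq : ∀ (U V : Ultrafilter ℕ) (a b : E), (U : Filter ℕ) ≤ atTop → (V : Filter ℕ) ≤ atTop →
      (∀ v, Tendsto (fun k => (inner ℝ (x k) v : ℝ)) U (𝓝 (inner ℝ a v))) →
      (∀ v, Tendsto (fun k => (inner ℝ (x k) v : ℝ)) V (𝓝 (inner ℝ b v))) → a = b := by
    intro U V a b hU hV ha hb
    obtain ⟨d, hd⟩ := hdist a (hcluster U a hU ha)
    obtain ⟨e, he⟩ := hdist b (hcluster V b hV hb)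
    -- By polarization this inner product is determined by the distances to `a` and `b`, so it
    -- converges along the whole sequence. Its limits along `U` and `V` therefore agree.
    have h : Tendsto (fun k => (inner ℝ (x k) (a - b) : ℝ)) atTop
        (𝓝 ((‖a‖ ^ 2 - ‖b‖ ^ 2 - (d ^ 2 - e ^ 2)) / 2)) := by
      have := (((hd.pow 2).sub (he.pow 2)).const_sub (‖a‖ ^ 2 - ‖b‖ ^ 2)).div_const 2
      refine this.congr fun k => ?_
      rw [norm_sub_sq_real, norm_sub_sq_real, inner_sub_right]
      ring
    have h1 := tendsto_nhds_unique (h.mono_left hU) (ha (a - b))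
    have h2 := tendsto_nhds_unique (h.mono_left hV) (hb (a - b))
    have h3 : (inner ℝ (a - b) (a - b) : ℝ) = 0 := by
      rw [inner_sub_left, ← h1, ← h2, sub_self]
    exact sub_eq_zero.1 (inner_self_eq_zero.1 h3)
  obtain ⟨a, ha⟩ := exists_tendsto_inner_of_bounded (Ultrafilter.of atTop) hM
  refine ⟨a, hcluster _ a (Ultrafilter.of_le _) ha, fun v => ?_⟩
  rw [tendsto_iff_ultrafilter]
  intro V hV
  obtain ⟨b, hb⟩ := exists_tendsto_inner_of_bounded V hM
  rw [huniq _ _ a b (Ultrafilter.of_le _) hV ha hb]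
  exact hb v

/-- The terms with index in `[N/2, N)` are at least `a N` and number at least `N/2`, so `N * a N ^
2` is at most twice a block of the series that tends to `0`. -/
theorem isLittleO_one_div_sqrt_of_antitone_of_summable_sq {a : ℕ → ℝ} (h0 : ∀ k, 0 ≤ a k)
    (hanti : Antitone a) (hsum : Summable fun k => a k ^ 2) :
    a =o[atTop] fun k : ℕ => 1 / √(k : ℝ) := by
  set f : ℕ → ℝ := fun N => ∑ k ∈ Finset.range N, a k ^ 2
  have hf := hsum.hasSum.tendsto_sum_nat
  have hdiv : Tendsto (fun N : ℕ => N / 2) atTop atTop :=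
    Nat.tendsto_div_const_atTop two_ne_zero
  have hdiff : Tendsto (fun N => 2 * (f N - f (N / 2))) atTop (𝓝 0) := by
    have := (hf.sub (hf.comp hdiv)).const_mul 2
    simpa using this
  have hbound : ∀ N : ℕ, N * a N ^ 2 ≤ 2 * (f N - f (N / 2)) := by
    intro N
    have h1 : f N - f (N / 2) = ∑ k ∈ Finset.Ico (N / 2) N, a k ^ 2 :=
      (Finset.sum_Ico_eq_sub _ (Nat.div_le_self N 2)).symm
    have h2 : ((Finset.Ico (N / 2) N).card : ℝ) * a N ^ 2 ≤ ∑ k ∈ Finset.Ico (N / 2) N, a k ^ 2 := by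
      rw [← nsmul_eq_mul]
      refine Finset.card_nsmul_le_sum _ _ _ fun k hk => ?_
      exact pow_le_pow_left₀ (h0 N) (hanti (Finset.mem_Ico.1 hk).2.le) 2
    have h3 : (N : ℝ) ≤ 2 * ((Finset.Ico (N / 2) N).card : ℝ) := by
      rw [Nat.card_Ico]; exact_mod_cast (by omega : N ≤ 2 * (N - N / 2))
    rw [h1]
    nlinarith [sq_nonneg (a N)]
  have hlim : Tendsto (fun N : ℕ => (N : ℝ) * a N ^ 2) atTop (𝓝 0) :=
    squeeze_zero (fun N => by positivity) hbound hdiff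
  rw [isLittleO_iff_tendsto']
  · have := hlim.sqrt
    rw [Real.sqrt_zero] at this
    refine this.congr fun N => ?_
    rw [Real.sqrt_mul (Nat.cast_nonneg N), Real.sqrt_sq (h0 N), div_div_eq_mul_div, div_one, mul_comm]
  · filter_upwards [eventually_gt_atTop 0] with N hN h
    have : (0 : ℝ) < 1 / √(N : ℝ) := by positivity
    exact absurd h this.ne'

/-- Convergence of the iteration of an averaged operator. -/
theorem averaged_iteration {S : E → E} {c : ℝ} (hc : 0 < c)
    (hS : ∀ x y, ‖S x - S y‖ ^ 2 ≤ ‖x - y‖ ^ 2 - c * ‖(x - S x) - (y - S y)‖ ^ 2)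
    {p : E} (hp : S p = p) {x : ℕ → E} (hx : ∀ k, x (k + 1) = S (x k)) :
    (∃ a, S a = a ∧ ∀ v, Tendsto (fun k => (inner ℝ (x k) v : ℝ)) atTop (𝓝 (inner ℝ a v))) ∧
      (∃ M, ∀ k, ‖x k‖ ≤ M) ∧ (fun k => ‖x k - S (x k)‖) =o[atTop] fun k : ℕ => 1 / √(k : ℝ) := by
  have hne : ∀ x y, ‖S x - S y‖ ≤ ‖x - y‖ := fun x y =>
    le_of_sq_le_sq ((hS x y).trans (sub_le_self _ (by positivity))) (norm_nonneg _)
  have hfix : ∀ q, S q = q → Antitone fun k => ‖x k - q‖ := fun q hq =>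
    antitone_nat_of_succ_le fun k => by
      have := hne (x k) q
      rwa [hq, ← hx] at this
  have hdist : ∀ q ∈ {q | S q = q}, ∃ d, Tendsto (fun k => ‖x k - q‖) atTop (𝓝 d) := fun q hq =>
    ⟨_, tendsto_atTop_ciInf (hfix q hq) ⟨0, by rintro _ ⟨k, rfl⟩; exact norm_nonneg _⟩⟩
  -- The next residual is `‖S (x k) - S (x (k + 1))‖`, at most the current one.
  have hanti : Antitone fun k => ‖x k - S (x k)‖ := antitone_nat_of_succ_le fun k => by
    have := hne (x k) (x (k + 1))
    simp only [hx k] at this ⊢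
    exact this
  have hsum : Summable fun k => ‖x k - S (x k)‖ ^ 2 := by
    refine summable_of_sum_range_le (c := c⁻¹ * ‖x 0 - p‖ ^ 2) (fun k => sq_nonneg _) fun N => ?_
    rw [inv_mul_eq_div, le_div_iff₀ hc, mul_comm, Finset.mul_sum]
    have : ∀ k, c * ‖x k - S (x k)‖ ^ 2 ≤ ‖x k - p‖ ^ 2 - ‖x (k + 1) - p‖ ^ 2 := fun k => by
      have := hS (x k) p
      rw [hp, sub_self, sub_zero, ← hx] at this
      rw [← hx]
      linarith
    calc _ ≤ ∑ k ∈ Finset.range N, (‖x k - p‖ ^ 2 - ‖x (k + 1) - p‖ ^ 2) :=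
          Finset.sum_le_sum fun k _ => this k
      _ = ‖x 0 - p‖ ^ 2 - ‖x N - p‖ ^ 2 := Finset.sum_range_sub' (fun k => ‖x k - p‖ ^ 2) N
      _ ≤ _ := sub_le_self _ (sq_nonneg _)
  have hres : Tendsto (fun k => ‖x k - S (x k)‖) atTop (𝓝 0) := by
    have := hsum.tendsto_atTop_zero.sqrt
    simpa [Real.sqrt_sq] using this
  have hM : ∀ k, ‖x k‖ ≤ ‖x 0 - p‖ + ‖p‖ := fun k => by
    calc ‖x k‖ = ‖(x k - p) + p‖ := by rw [sub_add_cancel]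
      _ ≤ _ := (norm_add_le _ _).trans (add_le_add_left (hfix p hp (Nat.zero_le k)) _)
  refine ⟨?_, ⟨_, hM⟩,
    isLittleO_one_div_sqrt_of_antitone_of_summable_sq (fun k => norm_nonneg _) hanti hsum⟩
  exact exists_tendsto_inner_of_opial ⟨p, hp⟩ hdist fun U a hU ha =>
    eq_of_tendsto_inner_of_nonexpansive hne hM ha (hres.mono_left hU)

end WeakConvergence

/-! ### Step-size condition and coercivity of the quadratic form -/

section StepSizeEstimates

/-- The gap is `α² / (α + β)`, so `α` and `β` may have either sign. -/
theorem mul_div_add_le_left {α β : ℝ} (h : 0 < α + β) : α * β / (α + β) ≤ α := by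
  rw [div_le_iff₀ h]; nlinarith [sq_nonneg α]

theorem mul_div_add_le_right {α β : ℝ} (h : 0 < α + β) : α * β / (α + β) ≤ β := by
  rw [div_le_iff₀ h]; nlinarith [sq_nonneg β]

/-- The gap is `‖α • a + β • b‖² / (α + β)`. -/
theorem mul_div_add_mul_norm_sub_sq_le {E : Type*} [NormedAddCommGroup E] [InnerProductSpace ℝ E]
    {α β : ℝ} (h : 0 < α + β) (a b : E) :
    α * β / (α + β) * ‖a - b‖ ^ 2 ≤ α * ‖a‖ ^ 2 + β * ‖b‖ ^ 2 := by
  rw [div_mul_eq_mul_div, div_le_iff₀ h]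
  have h1 := norm_add_sq_real (α • a) (β • b)
  rw [inner_smul_left, inner_smul_right, norm_smul, norm_smul, mul_pow, mul_pow, Real.norm_eq_abs,
    Real.norm_eq_abs, sq_abs, sq_abs, RCLike.conj_to_real] at h1
  have h2 := norm_sub_sq_real a b
  rw [h2]
  nlinarith [sq_nonneg ‖α • a + β • b‖]

/-- The hypotheses are open conditions, so they survive lowering both `C` and `α` by a small `η`.
The amounts removed are the two terms on the left. -/
theorem exists_pos_mul_le_quadratic {C l α β : ℝ} (hl : 0 < l) (h : 0 < α + β)
    (hC : 0 < C + 2 * l * (α * β / (α + β))) :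
    ∃ ε > 0, ∀ {E : Type*} [NormedAddCommGroup E] [InnerProductSpace ℝ E] (a b : E),
      ε * (‖a - b‖ ^ 2 + ‖a‖ ^ 2) ≤
        C * ‖a - b‖ ^ 2 + 2 * l * (α * ‖a‖ ^ 2 + β * ‖b‖ ^ 2) := by
  have hcont : ContinuousAt (fun η : ℝ =>
      C - η + 2 * l * ((α - η) * β / (α - η + β))) 0 := by
    have : α - 0 + β ≠ 0 := by rw [sub_zero]; exact h.ne'
    fun_prop (disch := assumption)
  have h1 : ∀ᶠ η : ℝ in 𝓝 0, 0 < C - η + 2 * l * ((α - η) * β / (α - η + β)) :=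
    hcont.eventually_const_lt (by simpa using hC)
  have h2 : ∀ᶠ η : ℝ in 𝓝 0, 0 < α - η + β := by
    have : ContinuousAt (fun η : ℝ => α - η + β) 0 := by fun_prop
    exact this.eventually_const_lt (by simpa using h)
  obtain ⟨η, ⟨h1, h2⟩, hη⟩ := (((h1.and h2).filter_mono nhdsWithin_le_nhds).and
    (self_mem_nhdsWithin (s := Set.Ioi (0 : ℝ)))).exists
  have hη : 0 < η := hη
  refine ⟨min η (2 * l * η), lt_min hη (by positivity), fun {E} _ _ a b => ?_⟩
  have h3 := mul_le_mul_of_nonneg_left (mul_div_add_mul_norm_sub_sq_le h2 a b)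
    (by positivity : 0 ≤ 2 * l)
  have h4 := mul_nonneg h1.le (sq_nonneg ‖a - b‖)
  have h5 := mul_le_mul_of_nonneg_right (min_le_left η (2 * l * η)) (sq_nonneg ‖a - b‖)
  have h6 := mul_le_mul_of_nonneg_right (min_le_right η (2 * l * η)) (sq_nonneg ‖a‖)
  linarith

variable {n : ℕ} {σ : Fin (n + 1) → ℝ} {w : Fin n → ℝ} {μ lam : ℝ}

/-- The last modulus can be split among the other ones so that every pair is either trivial or
satisfies the strict step-size inequality. -/
theorem exists_splitting (hμ : μ ∈ Set.Ioo (0 : ℝ) 2) (hw : ∀ i, 0 < w i) (hwsum : ∑ i, w i = 1)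
    {lamBar : EReal}
    (hcase : (NonmonotoneCase σ ∧ lamBar = optimalStep σ w μ) ∨ (MonotoneCase σ ∧ lamBar = ⊤))
    (hlam0 : 0 < lam) (hlam : (lam : EReal) < lamBar) :
    ∃ α : Fin n → ℝ, ∑ i, α i = σ (Fin.last n) ∧
      (∀ i, (α i = 0 ∧ σ i.castSucc = 0) ∨ (0 < α i + σ i.castSucc ∧
        0 < (2 - μ) * w i + 2 * lam * (α i * σ i.castSucc / (α i + σ i.castSucc)))) ∧
      ((NonmonotoneCase σ ∨ (MonotoneCase σ ∧ ∃ j, 0 < σ j)) →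
        ∃ i : Fin n, 0 < α i + σ i.castSucc) := by
  have hμ2 : 0 < 2 - μ := sub_pos.2 hμ.2
  rcases hcase with ⟨-, rfl⟩ | ⟨hmono, -⟩
  · obtain ⟨_, ⟨⟨δ, t⟩, ⟨ht0, hδ, hfeas⟩, rfl⟩, hlt⟩ := lt_sSup_iff.1 hlam
    simp only [EReal.coe_lt_coe_iff] at hlt
    simp only at ht0 hδ hfeas
    have ht : 0 < t := hlam0.trans hlt
    have hpair : ∀ i : NonzeroIdx σ, 0 < σ (Fin.last n) * δ i + σ i.1.castSucc ∧
        0 < (2 - μ) * w i.1 + 2 * lam * (σ (Fin.last n) * δ i * σ i.1.castSucc /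
          (σ (Fin.last n) * δ i + σ i.1.castSucc)) := by
      intro i
      obtain ⟨h1, h2, h3⟩ := hfeas i
      rw [add_comm] at h1 h2
      refine ⟨h1.lt_of_ne' h2, ?_⟩
      rw [show σ i.1.castSucc * σ (Fin.last n) * δ i / (σ i.1.castSucc + σ (Fin.last n) * δ i) =
        σ (Fin.last n) * δ i * σ i.1.castSucc / (σ (Fin.last n) * δ i + σ i.1.castSucc) by
          rw [add_comm (σ i.1.castSucc)]; ring] at h3
      set κ := σ (Fin.last n) * δ i * σ i.1.castSucc / (σ (Fin.last n) * δ i + σ i.1.castSucc)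
      have hwi := hw i.1
      have h4 : 0 ≤ (2 - μ) * w i.1 + 2 * t * κ := by
        have h5 := mul_nonneg h3 (by positivity : 0 ≤ 2 * w i.1)
        have h6 : (1 + t / w i.1 * κ - μ / 2) * (2 * w i.1) = (2 - μ) * w i.1 + 2 * t * κ := by
          field_simp; ring
        rwa [h6] at h5
      have h5 := mul_nonneg h4 hlam0.le
      have h6 : 0 < (t - lam) * ((2 - μ) * w i.1) :=
        mul_pos (sub_pos.2 hlt) (mul_pos hμ2 hwi)
      -- The left factor times the bracket is `lam * ((2 - μ) * w i + 2 * t * κ) + (t - lam) * ((2 -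
      -- μ) * w i)`: the weak inequality at `t` becomes strict at `lam < t`, whatever the sign of
      -- `κ`.
      have h7 : 0 < t * ((2 - μ) * w i.1 + 2 * lam * κ) := by linarith
      exact pos_of_mul_pos_right h7 ht.le
    refine ⟨fun i => if h : σ i.castSucc ≠ 0 then σ (Fin.last n) * δ ⟨i, h⟩ else 0, ?_, ?_, ?_⟩
    · have h1 : ∑ i, σ (Fin.last n) * δ i = σ (Fin.last n) := by
        rw [← Finset.mul_sum, hδ, mul_one]
      have h2 := Finset.sum_subtype (Finset.univ.filter fun i : Fin n => σ i.castSucc ≠ 0)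
        (p := fun i => σ i.castSucc ≠ 0) (F := inferInstance) (by simp)
        (fun i => if h : σ i.castSucc ≠ 0 then σ (Fin.last n) * δ ⟨i, h⟩ else 0)
      rw [Finset.sum_filter_of_ne (fun i _ h => by by_contra h0; simp [h0] at h)] at h2
      refine (h2.trans (Finset.sum_congr rfl fun i _ => ?_)).trans h1
      simp [i.2]
    · intro i
      by_cases h : σ i.castSucc = 0
      · left; simp [h]
      · right; simpa [h] using hpair ⟨i, h⟩
    · intro _
      -- An empty index set would contradict `∑ i, δ i = 1`.
      obtain ⟨i⟩ : Nonempty (NonzeroIdx σ) := by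
        by_contra h
        rw [not_nonempty_iff] at h
        simp at hδ
      exact ⟨i.1, by simpa [i.2] using (hpair i).1⟩
  -- With nonnegative moduli, splitting in proportion to the weights works for every `lam`, as no
  -- quotient is negative.
  · refine ⟨fun i => σ (Fin.last n) * w i, by rw [← Finset.mul_sum, hwsum, mul_one], ?_, ?_⟩
    · intro i
      have h1 := mul_nonneg (hmono (Fin.last n)) (hw i).le
      have h2 := hmono i.castSucc
      rcases (add_nonneg h1 h2).eq_or_lt with h | h
      · left; constructor <;> linarith
      · right
        have := hw i
        exact ⟨h, by positivity⟩
    · intro h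
      obtain ⟨j, hj⟩ : ∃ j, 0 < σ j := by
        rcases h with h | h
        · obtain ⟨j, hj⟩ := h.1
          exact absurd (hmono j) hj.not_ge
        · exact h.2
      induction j using Fin.lastCases with
      | last =>
        have hne : (Finset.univ : Finset (Fin n)).Nonempty := by
          rw [Finset.nonempty_iff_ne_empty]
          intro h; simp [h] at hwsum
        obtain ⟨i, -⟩ := hne
        exact ⟨i, add_pos_of_pos_of_nonneg (mul_pos hj (hw i)) (hmono _)⟩
      | cast i => exact ⟨i, add_pos_of_nonneg_of_pos (mul_nonneg (hmono _) (hw i).le) hj⟩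

/-- The quotient is at most `α i` and at most `σ i`, so the pair condition gives `2 * (w i + lam * σ
i) > μ * w i > 0` and likewise for `α i`. Summing the latter over `i` handles the last operator. -/
theorem resolvent_moduli_pos (hμ : μ ∈ Set.Ioo (0 : ℝ) 2) (hw : ∀ i, 0 < w i)
    (hwsum : ∑ i, w i = 1) {α : Fin n → ℝ} (hsum : ∑ i, α i = σ (Fin.last n)) (hlam0 : 0 < lam)
    (hα : ∀ i, (α i = 0 ∧ σ i.castSucc = 0) ∨ (0 < α i + σ i.castSucc ∧
      0 < (2 - μ) * w i + 2 * lam * (α i * σ i.castSucc / (α i + σ i.castSucc)))) :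
    (∀ i : Fin n, 0 < 1 + lam / w i * σ i.castSucc) ∧ 0 < 1 + lam * σ (Fin.last n) := by
  have key : ∀ i, 0 < w i + lam * σ i.castSucc ∧ 0 < w i + lam * α i := by
    intro i
    have hwi := hw i
    rcases hα i with ⟨h1, h2⟩ | ⟨h1, h2⟩
    · simp [h1, h2, hwi]
    · have h3 := mul_le_mul_of_nonneg_left (mul_div_add_le_left h1) hlam0.le
      have h4 := mul_le_mul_of_nonneg_left (mul_div_add_le_right h1) hlam0.le
      have h5 := mul_pos hμ.1 hwi
      constructor <;> linarith
  constructor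
  · intro i
    have h := div_pos (key i).1 (hw i)
    rwa [add_div, div_self (hw i).ne', mul_div_right_comm] at h
  · rw [← hwsum, ← hsum, Finset.mul_sum, ← Finset.sum_add_distrib]
    refine Finset.sum_pos (fun i _ => (key i).2) ?_
    rw [Finset.nonempty_iff_ne_empty]
    intro h; simp [h] at hwsum

/-- Writing `σ m = ∑ α i` turns the form into a sum over pairs `(a, b i)`, each nonnegative and
coercive in `a - b i`. One pair with `α i + σ i > 0` is enough to control `‖a‖²`. -/
theorem exists_pos_mul_le_sum_quadratic {α : Fin n → ℝ}
    (hμ : μ ∈ Set.Ioo (0 : ℝ) 2) (hw : ∀ i, 0 < w i) (hsum : ∑ i, α i = σ (Fin.last n))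
    (hlam0 : 0 < lam)
    (hα : ∀ i, (α i = 0 ∧ σ i.castSucc = 0) ∨ (0 < α i + σ i.castSucc ∧
      0 < (2 - μ) * w i + 2 * lam * (α i * σ i.castSucc / (α i + σ i.castSucc))))
    (E : Type*) [NormedAddCommGroup E] [InnerProductSpace ℝ E] :
    ∃ ε > 0, ∀ (a : E) (b : Fin n → E),
      ε * ∑ i, ‖a - b i‖ ^ 2 ≤ (2 - μ) * ∑ i, w i * ‖a - b i‖ ^ 2 +
        2 * lam * (σ (Fin.last n) * ‖a‖ ^ 2 + ∑ i : Fin n, σ i.castSucc * ‖b i‖ ^ 2) ∧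
      ((∃ i : Fin n, 0 < α i + σ i.castSucc) →
        ε * ‖a‖ ^ 2 ≤ (2 - μ) * ∑ i, w i * ‖a - b i‖ ^ 2 +
        2 * lam * (σ (Fin.last n) * ‖a‖ ^ 2 + ∑ i : Fin n, σ i.castSucc * ‖b i‖ ^ 2)) := by
  have hμ2 : 0 < 2 - μ := sub_pos.2 hμ.2
  have key : ∀ i, ∃ ε > 0, ∀ a b : E,
      ε * ‖a - b‖ ^ 2 ≤ (2 - μ) * w i * ‖a - b‖ ^ 2 +
        2 * lam * (α i * ‖a‖ ^ 2 + σ i.castSucc * ‖b‖ ^ 2) ∧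
      (0 < α i + σ i.castSucc → ε * (‖a - b‖ ^ 2 + ‖a‖ ^ 2) ≤
        (2 - μ) * w i * ‖a - b‖ ^ 2 + 2 * lam * (α i * ‖a‖ ^ 2 + σ i.castSucc * ‖b‖ ^ 2)) := by
    intro i
    rcases hα i with ⟨h1, h2⟩ | ⟨h1, h2⟩
    · exact ⟨(2 - μ) * w i, mul_pos hμ2 (hw i), fun a b => by simp [h1, h2]⟩
    · obtain ⟨ε, hε, h⟩ := exists_pos_mul_le_quadratic hlam0 h1 h2
      refine ⟨ε, hε, fun a b => ⟨le_trans ?_ (h a b), fun _ => h a b⟩⟩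
      nlinarith [mul_nonneg hε.le (sq_nonneg ‖a‖)]
  choose ε hε h using key
  obtain ⟨e, he, hle⟩ : ∃ e > 0, ∀ i, e ≤ ε i := by
    rcases isEmpty_or_nonempty (Fin n) with _ | _
    · exact ⟨1, one_pos, fun i => isEmptyElim i⟩
    · obtain ⟨i, hi⟩ := Finite.exists_min ε
      exact ⟨ε i, hε i, hi⟩
  have hQ : ∀ (a : E) (b : Fin n → E), (2 - μ) * ∑ i, w i * ‖a - b i‖ ^ 2 +
        2 * lam * (σ (Fin.last n) * ‖a‖ ^ 2 + ∑ i : Fin n, σ i.castSucc * ‖b i‖ ^ 2) =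
      ∑ i, ((2 - μ) * w i * ‖a - b i‖ ^ 2 +
        2 * lam * (α i * ‖a‖ ^ 2 + σ i.castSucc * ‖b i‖ ^ 2)) := by
    intro a b
    rw [← hsum, Finset.sum_mul, ← Finset.sum_add_distrib, Finset.mul_sum, Finset.mul_sum,
      ← Finset.sum_add_distrib]
    exact Finset.sum_congr rfl fun i _ => by ring
  refine ⟨e, he, fun a b => ?_⟩
  rw [hQ]
  constructor
  · rw [Finset.mul_sum]
    exact Finset.sum_le_sum fun i _ =>
      (mul_le_mul_of_nonneg_right (hle i) (sq_nonneg _)).trans (h i a (b i)).1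
  · rintro ⟨i, hi⟩
    refine le_trans ?_ (Finset.single_le_sum (fun j _ => ?_) (Finset.mem_univ i))
    · refine le_trans ?_ ((h i a (b i)).2 hi)
      exact mul_le_mul (hle i) (le_add_of_nonneg_left (sq_nonneg _)) (sq_nonneg _) (hε i).le
    · exact (mul_nonneg (hε j).le (sq_nonneg _)).trans (h j a (b j)).1

end StepSizeEstimates

/-! ### Weighted norms and warped resolvents on the product space -/

section ProductSpaceOperators

@[simp]
theorem diagEmb_apply {H : Type*} {n : ℕ} (x : H) (i : Fin n) : diagEmb H n x i = x := rfl

variable {H : Type*} [NormedAddCommGroup H] [InnerProductSpace ℝ H] {n : ℕ}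

@[simp]
theorem weightMap_apply (w : Fin n → ℝ) (x : ProdSpace H n) (i : Fin n) :
    weightMap H w x i = w i • x i := rfl

theorem inner_weightMap_left (w : Fin n → ℝ) (x y : ProdSpace H n) :
    (inner ℝ (weightMap H w x) y : ℝ) = inner ℝ x (weightMap H w y) := by
  simp [PiLp.inner_apply, inner_smul_left, inner_smul_right]

theorem weightMap_weightMap_of_mul_eq_one {v w : Fin n → ℝ} (h : ∀ i, v i * w i = 1)
    (x : ProdSpace H n) : weightMap H v (weightMap H w x) = x := by
  ext i; simp [smul_smul, h]

theorem norm_weightMap_sqrt_sq {w : Fin n → ℝ} (hw : ∀ i, 0 ≤ w i) (x : ProdSpace H n) :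
    ‖weightMap H (fun i => √(w i)) x‖ ^ 2 = ∑ i, w i * ‖x i‖ ^ 2 := by
  simp [PiLp.norm_sq_eq_of_L2, norm_smul, mul_pow, hw]

theorem norm_weightMap_le (w : Fin n → ℝ) (x : ProdSpace H n) :
    ‖weightMap H w x‖ ≤ √(∑ i, w i ^ 2) * ‖x‖ := by
  refine le_of_sq_le_sq ?_ (by positivity)
  rw [mul_pow, Real.sq_sqrt (by positivity), PiLp.norm_sq_eq_of_L2, Finset.sum_mul]
  refine Finset.sum_le_sum fun i _ => ?_
  rw [weightMap_apply, norm_smul, mul_pow, Real.norm_eq_abs, sq_abs]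
  have := PiLp.norm_apply_le x i
  gcongr

/-- Convergence of the iteration of an operator that is averaged in a weighted norm. -/
theorem weighted_averaged_iteration [CompleteSpace H] {w : Fin n → ℝ} (hw : ∀ i, 0 < w i)
    {T : ProdSpace H n → ProdSpace H n} {c : ℝ} (hc : 0 < c)
    (hT : ∀ x y, ∑ i, w i * ‖(T x - T y) i‖ ^ 2 ≤ ∑ i, w i * ‖(x - y) i‖ ^ 2 -
      c * ∑ i, w i * ‖((x - T x) - (y - T y)) i‖ ^ 2)
    {p : ProdSpace H n} (hp : T p = p) {x : ℕ → ProdSpace H n} (hx : ∀ k, x (k + 1) = T (x k)) :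
    (∃ a, T a = a ∧ WeaklyConverges x a) ∧ (∃ M, ∀ k, ‖x k‖ ≤ M) ∧
      (fun k => ‖x k - T (x k)‖) =o[atTop] fun k : ℕ => 1 / √(k : ℝ) := by
  -- `Φ` is an isometry from the weighted norm to the standard one, so `T` conjugated by it is
  -- averaged. Self-adjointness of `Ψ` carries the weak limit back.
  set Φ := weightMap H (n := n) fun i => √(w i)
  set Ψ := weightMap H (n := n) fun i => (√(w i))⁻¹
  have hw' : ∀ i, √(w i) ≠ 0 := fun i => (Real.sqrt_pos.2 (hw i)).ne'
  have hΨΦ : ∀ y, Ψ (Φ y) = y := weightMap_weightMap_of_mul_eq_one fun i => inv_mul_cancel₀ (hw' i)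
  have hΦΨ : ∀ y, Φ (Ψ y) = y := weightMap_weightMap_of_mul_eq_one fun i => mul_inv_cancel₀ (hw' i)
  have hnorm : ∀ y, ‖Φ y‖ ^ 2 = ∑ i, w i * ‖y i‖ ^ 2 := norm_weightMap_sqrt_sq fun i => (hw i).le
  have hS : ∀ x y, ‖Φ (T (Ψ x)) - Φ (T (Ψ y))‖ ^ 2 ≤ ‖x - y‖ ^ 2 -
      c * ‖(x - Φ (T (Ψ x))) - (y - Φ (T (Ψ y)))‖ ^ 2 := by
    intro x y
    have h := hT (Ψ x) (Ψ y)
    rw [← hnorm, ← hnorm, ← hnorm] at h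
    simpa only [map_sub, hΦΨ] using h
  obtain ⟨⟨a, ha, hweak⟩, ⟨M, hM⟩, hrate⟩ := averaged_iteration hc hS (p := Φ p) (x := fun k => Φ (x k))
    (by rw [hΨΦ, hp]) (fun k => by rw [hΨΦ, hx])
  refine ⟨⟨Ψ a, by rw [← hΨΦ (T (Ψ a)), ha], weaklyConverges_iff_forall_inner.2 fun v => ?_⟩,
    ⟨√(∑ i, ((√(w i))⁻¹) ^ 2) * M, fun k => ?_⟩, ?_⟩
  · rw [inner_weightMap_left]
    refine (hweak (Ψ v)).congr fun k => ?_
    rw [← inner_weightMap_left]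
    change inner ℝ (Ψ (Φ (x k))) v = _
    rw [hΨΦ]
  · have := norm_weightMap_le (fun i => (√(w i))⁻¹) (Φ (x k))
    change ‖Ψ (Φ (x k))‖ ≤ _ at this
    rw [hΨΦ] at this
    exact this.trans (mul_le_mul_of_nonneg_left (hM k) (Real.sqrt_nonneg _))
  · refine IsBigO.trans_isLittleO (IsBigO.of_bound (√(∑ i, ((√(w i))⁻¹) ^ 2))
      (Eventually.of_forall fun k => ?_)) hrate
    rw [hΨΦ, norm_norm, norm_norm, ← map_sub]
    have := norm_weightMap_le (fun i => (√(w i))⁻¹) (Φ (x k - T (x k)))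
    change ‖Ψ (Φ (x k - T (x k)))‖ ≤ _ at this
    rwa [hΨΦ] at this

theorem mem_normalConeOp_diagSet_iff (hn : 0 < n) {p x : ProdSpace H n} :
    p ∈ normalConeOp (diagSet H n) x ↔ x ∈ diagSet H n ∧ ∑ i, p i = 0 := by
  refine and_congr_right fun hx => ⟨fun h => ?_, fun h y hy => ?_⟩
  -- Moving along the diagonal by `∑ i, p i` yields `‖∑ i, p i‖² ≤ 0`.
  · have h1 := h (x + diagEmb H n (∑ i, p i)) (fun i j => by simp [hx i j])
    rw [add_sub_cancel_left, PiLp.inner_apply] at h1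
    simp only [diagEmb_apply] at h1
    rw [← sum_inner, real_inner_self_eq_norm_sq] at h1
    exact norm_eq_zero.1 (pow_eq_zero_iff two_ne_zero |>.1 (le_antisymm h1 (sq_nonneg _)))
  · have h1 : y - x = diagEmb H n (y ⟨0, hn⟩ - x ⟨0, hn⟩) := by
      ext i; simp [hx i ⟨0, hn⟩, hy i ⟨0, hn⟩]
    rw [h1, PiLp.inner_apply]
    simp only [diagEmb_apply]
    rw [← sum_inner, h, inner_zero_left]

variable {A : Fin (n + 1) → H → Set H} {w : Fin n → ℝ} {lam μ : ℝ}

theorem mem_resF_iff (hw : ∀ i, 0 < w i) {p z : ProdSpace H n} :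
    z ∈ resF A w lam p ↔ ∀ i, z i ∈ resolventOp (lam / w i) (A i.castSucc) (p i) := by
  constructor
  · rintro ⟨v, hv, rfl⟩ i
    refine ⟨w i • v i, hv i, ?_⟩
    rw [smul_smul, div_mul_cancel₀ _ (hw i).ne']
    rfl
  · intro h
    choose u hu hp using h
    refine ⟨WithLp.toLp 2 fun i => (w i)⁻¹ • u i, fun i => ?_, ?_⟩
    · simpa [smul_inv_smul₀ (hw i).ne'] using hu i
    · ext i
      simp [hp i, smul_smul, div_eq_mul_inv]

/-- Taking the weighted average of the inclusion removes the normal vector, whose components sum to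
zero. Conversely, what remains after subtracting the `K`-part has components with sum zero, hence is
normal. -/
theorem mem_resG_iff (hlam : 0 < lam) (hwsum : ∑ i, w i = 1)
    {q y : ProdSpace H n} :
    y ∈ resG A w lam q ↔
      ∃ ξ ∈ resolventOp lam (A (Fin.last n)) (∑ i, w i • q i), y = diagEmb H n ξ := by
  have hn : 0 < n := by
    rcases Nat.eq_zero_or_pos n with rfl | h
    · simp at hwsum
    · exact h
  constructor
  · rintro ⟨v, hv, rfl⟩
    obtain ⟨_, ⟨ξ, rfl, v₀, hv₀, rfl⟩, ν, hν, hsum⟩ := hv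
    have hν' := ((mem_normalConeOp_diagSet_iff hn).1 hν).2
    refine ⟨ξ, ⟨v₀, hv₀, ?_⟩, rfl⟩
    have h1 : ∑ i, w i • v i = v₀ := by
      have : ∀ i, w i • v i = w i • v₀ + ν i := fun i => by
        have := congrArg (fun f : ProdSpace H n => f i) hsum
        simpa using this.symm
      simp only [this, Finset.sum_add_distrib, hν', add_zero, ← Finset.sum_smul, hwsum, one_smul]
    simp only [PiLp.add_apply, PiLp.smul_apply, diagEmb_apply, smul_add, Finset.sum_add_distrib,
      ← Finset.sum_smul, hwsum, one_smul, smul_comm _ lam, ← Finset.smul_sum, h1]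
  · rintro ⟨ξ, ⟨v₀, hv₀, hq⟩, rfl⟩
    have hl := hlam.ne'
    refine ⟨lam⁻¹ • (q - diagEmb H n ξ), ?_, by rw [smul_inv_smul₀ hl]; abel⟩
    refine Set.mem_add.2 ⟨_, ⟨ξ, rfl, v₀, hv₀, rfl⟩,
      weightMap H w (lam⁻¹ • (q - diagEmb H n ξ) - diagEmb H n v₀), ?_, ?_⟩
    · refine (mem_normalConeOp_diagSet_iff hn).2 ⟨fun i j => rfl, ?_⟩
      simp only [weightMap_apply, PiLp.sub_apply, PiLp.smul_apply, diagEmb_apply, smul_sub,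
        Finset.sum_sub_distrib, ← Finset.sum_smul, hwsum, one_smul, smul_comm _ lam⁻¹,
        ← Finset.smul_sum, hq, smul_add, inv_smul_smul₀ hl]
      abel
    · rw [map_sub]; abel

end ProductSpaceOperators

/-! ### The Douglas–Rachford step: energy identity and fixed points -/

section DouglasRachford

variable {H : Type*} [NormedAddCommGroup H] [InnerProductSpace ℝ H] {n : ℕ}

theorem tendsto_inner_zero_of_bounded {ι : Type*} {l : Filter ι} {p q : ι → H} {B : ℝ}
    (hp : Tendsto p l (𝓝 0)) (hq : ∀ i, ‖q i‖ ≤ B) :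
    Tendsto (fun i => (inner ℝ (p i) (q i) : ℝ)) l (𝓝 0) := by
  have h := hp.norm.mul_const B
  rw [norm_zero, zero_mul] at h
  exact squeeze_zero_norm (fun i => (norm_inner_le_norm _ _).trans
    (mul_le_mul_of_nonneg_left (hq i) (norm_nonneg _))) h

/-- A demiclosedness principle for finite families of maximal monotone operators. -/
theorem mem_of_tendsto_inner_of_tendsto_sum_inner [CompleteSpace H] {ι κ : Type*} [Fintype ι]
    {l : Filter κ} [l.NeBot] {A : ι → H → Set H} (hA : ∀ i, IsMaximalSigmaMonotone 0 (A i))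
    {z u : κ → ι → H} {ζ η : ι → H} (hmem : ∀ k i, u k i ∈ A i (z k i))
    (hz : ∀ i v, Tendsto (fun k => (inner ℝ (z k i) v : ℝ)) l (𝓝 (inner ℝ (ζ i) v)))
    (hu : ∀ i v, Tendsto (fun k => (inner ℝ (u k i) v : ℝ)) l (𝓝 (inner ℝ (η i) v)))
    (hlim : Tendsto (fun k => ∑ i, (inner ℝ (z k i) (u k i) : ℝ)) l
      (𝓝 (∑ i, inner ℝ (ζ i) (η i)))) (i : ι) : η i ∈ A i (ζ i) := by
  -- Minty's theorem supplies the test pairs. Against them, monotonicity summed over `i` (only the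
  -- total inner product is known to converge) becomes `-∑ ‖ζ i - a i‖² ≥ 0` in the limit.
  have hres : ∀ i, ∃ a b, b ∈ A i a ∧ ζ i + η i = a + b := fun i => by
    obtain ⟨a, b, hb, h⟩ := (hA i).exists_mem_resolventOp one_pos (by simp) (ζ i + η i)
    exact ⟨a, b, hb, by rw [h, one_smul]⟩
  choose a b hb hab using hres
  have hnonneg : ∀ k, 0 ≤ ∑ i, (inner ℝ (z k i) (u k i) : ℝ) -
      ∑ i, (inner ℝ (z k i) (b i) + inner ℝ (u k i) (a i) - inner ℝ (a i) (b i) : ℝ) := by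
    intro k
    rw [← Finset.sum_sub_distrib]
    refine Finset.sum_nonneg fun i _ => ?_
    have := (hA i).prop _ _ _ _ (hmem k i) (hb i)
    simp only [inner_sub_left, inner_sub_right, zero_mul] at this
    rw [real_inner_comm (a i) (u k i)]
    linarith
  have hlim' := hlim.sub (tendsto_finsetSum Finset.univ fun i _ =>
    ((hz i (b i)).add (hu i (a i))).sub_const (inner ℝ (a i) (b i)))
  have h0 := ge_of_tendsto' hlim' hnonneg
  rw [← Finset.sum_sub_distrib] at h0
  have h1 : ∀ i, (inner ℝ (ζ i) (η i) - (inner ℝ (ζ i) (b i) + inner ℝ (η i) (a i) -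
      inner ℝ (a i) (b i)) : ℝ) = -‖ζ i - a i‖ ^ 2 := by
    intro i
    have h2 : b i = ζ i + η i - a i := by rw [hab i]; abel
    rw [h2, ← real_inner_self_eq_norm_sq]
    simp only [inner_sub_left, inner_sub_right, inner_add_right]
    rw [real_inner_comm (a i) (η i), real_inner_comm (a i) (ζ i)]
    ring
  simp only [h1, Finset.sum_neg_distrib] at h0
  have h2 : ∑ i, ‖ζ i - a i‖ ^ 2 = 0 :=
    le_antisymm (by linarith) (Finset.sum_nonneg fun i _ => sq_nonneg _)
  have h3 := (Finset.sum_eq_zero_iff_of_nonneg fun i _ => sq_nonneg _).1 h2 i (Finset.mem_univ i)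
  have h4 : ζ i = a i := sub_eq_zero.1 (norm_eq_zero.1 (pow_eq_zero_iff two_ne_zero |>.1 h3))
  have h5 : η i = b i := by
    have := hab i
    rw [h4] at this
    exact add_left_cancel this
  rw [h4, h5]
  exact hb i

/-- Pure algebra, meant for differences of two steps: `u` and `v` stand for differences of operator
values, so monotonicity enters only through the inner products on the right. -/
theorem sum_mul_norm_add_smul_sub_sq {w : Fin n → ℝ} (hwsum : ∑ i, w i = 1) {lam : ℝ} (μ : ℝ)
    {x z u : Fin n → H} {a v : H} (hx : ∀ i, w i • x i = w i • z i + lam • u i)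
    (ha : ∑ i, w i • ((2 : ℝ) • z i - x i) = a + lam • v) :
    ∑ i, w i * ‖x i + μ • (a - z i)‖ ^ 2 = ∑ i, w i * ‖x i‖ ^ 2 -
      μ * ((2 - μ) * ∑ i, w i * ‖a - z i‖ ^ 2 +
        2 * lam * (inner ℝ a v + ∑ i, inner ℝ (z i) (u i))) := by
  have h1 : ∑ i, (w i • z i - lam • u i) = a + lam • v := by
    rw [← ha]
    refine Finset.sum_congr rfl fun i _ => ?_
    rw [smul_sub, hx]; module
  -- Arranged so that, by `h1`, the last two terms sum over `i` to `⟪a, a⟫ - ⟪a, a + lam • v⟫ = -lam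
  -- * ⟪a, v⟫`.
  have h2 : ∀ i, w i * inner ℝ (x i) (a - z i) = -(w i * ‖a - z i‖ ^ 2) -
      lam * inner ℝ (z i) (u i) + w i * inner ℝ a a - inner ℝ a (w i • z i - lam • u i) := by
    intro i
    rw [← real_inner_smul_left, hx, ← real_inner_self_eq_norm_sq]
    simp only [inner_sub_left, inner_sub_right, inner_add_left, inner_smul_left, inner_smul_right,
      RCLike.conj_to_real]
    rw [real_inner_comm a (z i), real_inner_comm a (u i), real_inner_comm (z i) (u i)]
    ring
  have h3 : ∑ i, w i * inner ℝ (x i) (a - z i) = -∑ i, w i * ‖a - z i‖ ^ 2 -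
      lam * ∑ i, inner ℝ (z i) (u i) - lam * inner ℝ a v := by
    simp only [h2]
    rw [Finset.sum_sub_distrib, Finset.sum_add_distrib, Finset.sum_sub_distrib, ← inner_sum, h1,
      ← Finset.sum_mul, hwsum, Finset.sum_neg_distrib, ← Finset.mul_sum, inner_add_right,
      inner_smul_right]
    ring
  have h4 : ∀ i, w i * ‖x i + μ • (a - z i)‖ ^ 2 = w i * ‖x i‖ ^ 2 +
      2 * μ * (w i * inner ℝ (x i) (a - z i)) + μ ^ 2 * (w i * ‖a - z i‖ ^ 2) := by
    intro i
    rw [norm_add_sq_real, norm_smul, inner_smul_right, mul_pow, Real.norm_eq_abs, sq_abs]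
    ring
  simp only [h4]
  rw [Finset.sum_add_distrib, Finset.sum_add_distrib, ← Finset.mul_sum, ← Finset.mul_sum, h3]
  ring

/-- The componentwise application of a family of maps. -/
def piMap (J : Fin n → H → H) (p : ProdSpace H n) : ProdSpace H n := WithLp.toLp 2 fun i => J i (p i)

/-- The common component of the second shadow point `y` of the Douglas-Rachford step at `p`. -/
def drShadow (w : Fin n → ℝ) (J : Fin n → H → H) (J' : H → H) (p : ProdSpace H n) : H :=
  J' (∑ i, w i • ((2 : ℝ) • J i (p i) - p i))

/-- The single-valued Douglas-Rachford step. -/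
def drMap (w : Fin n → ℝ) (μ : ℝ) (J : Fin n → H → H) (J' : H → H) (p : ProdSpace H n) :
    ProdSpace H n :=
  p + μ • (diagEmb H n (drShadow w J J' p) - piMap J p)

variable {A : Fin (n + 1) → H → Set H} {σ : Fin (n + 1) → ℝ} {w : Fin n → ℝ} {lam μ : ℝ}
  {J : Fin n → H → H} {J' : H → H}

theorem sum_mul_norm_drMap_sub_sq_le (hA : ∀ i, IsSigmaMonotone (σ i) (A i)) (hw : ∀ i, 0 < w i)
    (hwsum : ∑ i, w i = 1) (hlam : 0 < lam) (hμ : 0 < μ)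
    (hJ : ∀ i x, J i x ∈ resolventOp (lam / w i) (A i.castSucc) x)
    (hJ' : ∀ x, J' x ∈ resolventOp lam (A (Fin.last n)) x) (p q : ProdSpace H n) :
    ∑ i, w i * ‖(drMap w μ J J' p - drMap w μ J J' q) i‖ ^ 2 ≤ ∑ i, w i * ‖(p - q) i‖ ^ 2 -
      μ * ((2 - μ) * ∑ i, w i * ‖(drShadow w J J' p - drShadow w J J' q) -
          (J i (p i) - J i (q i))‖ ^ 2 +
        2 * lam * (σ (Fin.last n) * ‖drShadow w J J' p - drShadow w J J' q‖ ^ 2 +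
          ∑ i : Fin n, σ i.castSucc * ‖J i (p i) - J i (q i)‖ ^ 2)) := by
  choose u hu hup using fun i => hJ i (p i)
  choose u' hu' huq using fun i => hJ i (q i)
  obtain ⟨v, hv, hvp⟩ := hJ' (∑ i, w i • ((2 : ℝ) • J i (p i) - p i))
  obtain ⟨v', hv', hvq⟩ := hJ' (∑ i, w i • ((2 : ℝ) • J i (q i) - q i))
  have hsm : ∀ i (a b : H), w i • (a + (lam / w i) • b) = w i • a + lam • b := fun i a b => by
    rw [smul_add, smul_smul, mul_div_cancel₀ _ (hw i).ne']
  have h := sum_mul_norm_add_smul_sub_sq hwsum μ (lam := lam) (x := fun i => p i - q i)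
    (z := fun i => J i (p i) - J i (q i)) (u := fun i => u i - u' i)
    (a := drShadow w J J' p - drShadow w J J' q) (v := v - v')
    (fun i => by
      have h1 := congrArg (w i • ·) (hup i)
      have h2 := congrArg (w i • ·) (huq i)
      simp only [hsm] at h1 h2
      rw [smul_sub, h1, h2]; module)
    (by
      have h1 : ∀ i, w i • ((2 : ℝ) • (J i (p i) - J i (q i)) - (p i - q i)) =
        w i • ((2 : ℝ) • J i (p i) - p i) - w i • ((2 : ℝ) • J i (q i) - q i) := fun i => by module
      simp only [h1]
      rw [Finset.sum_sub_distrib, hvp, hvq, drShadow, drShadow]; module)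
  have h1 : ∀ i, (drMap w μ J J' p - drMap w μ J J' q) i = p i - q i +
      μ • (drShadow w J J' p - drShadow w J J' q - (J i (p i) - J i (q i))) := fun i => by
    simp only [drMap, piMap, PiLp.sub_apply, PiLp.add_apply, PiLp.smul_apply, diagEmb_apply]
    module
  simp only [h1]
  rw [h]
  have h2 : ∑ i : Fin n, σ i.castSucc * ‖J i (p i) - J i (q i)‖ ^ 2 ≤
      ∑ i, inner ℝ (J i (p i) - J i (q i)) (u i - u' i) :=
    Finset.sum_le_sum fun i _ => hA _ _ _ _ _ (hu i) (hu' i)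
  have h3 : σ (Fin.last n) * ‖drShadow w J J' p - drShadow w J J' q‖ ^ 2 ≤
      inner ℝ (drShadow w J J' p - drShadow w J J' q) (v - v') := hA _ _ _ _ _ hv hv'
  have h4 := mul_le_mul_of_nonneg_left (add_le_add h3 h2) (by positivity : 0 ≤ 2 * lam * μ)
  simp only [PiLp.sub_apply]
  linarith

theorem piMap_eq_of_drMap_eq (hμ : μ ≠ 0) {p : ProdSpace H n} (hp : drMap w μ J J' p = p) :
    piMap J p = diagEmb H n (drShadow w J J' p) := by
  have := (smul_eq_zero.1 (add_eq_left.1 hp)).resolve_left hμ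
  exact (sub_eq_zero.1 this).symm

/-- At a fixed point every `J i (p i)` equals the shadow `ξ`, so the weighted average of `2ξ - p i`
is `ξ - lam • ∑ u i`. It is also `ξ + lam • v`, whence `∑ u i + v = 0`. -/
theorem drShadow_mem_zerosOf (hw : ∀ i, 0 < w i) (hwsum : ∑ i, w i = 1) (hlam : 0 < lam)
    (hμ : μ ≠ 0) (hJ : ∀ i x, J i x ∈ resolventOp (lam / w i) (A i.castSucc) x)
    (hJ' : ∀ x, J' x ∈ resolventOp lam (A (Fin.last n)) x) {p : ProdSpace H n}
    (hp : drMap w μ J J' p = p) : drShadow w J J' p ∈ zerosOf (sumOp A) := by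
  have hz : ∀ i, J i (p i) = drShadow w J J' p := fun i =>
    congrArg (fun f : ProdSpace H n => f i) (piMap_eq_of_drMap_eq hμ hp)
  choose u hu hup using fun i => hJ i (p i)
  obtain ⟨v, hv, hvp⟩ := hJ' (∑ i, w i • ((2 : ℝ) • J i (p i) - p i))
  change v ∈ A _ (drShadow w J J' p) at hv
  change _ = drShadow w J J' p + _ at hvp
  set ξ := drShadow w J J' p
  have h1 : ∀ i, w i • ((2 : ℝ) • J i (p i) - p i) = w i • ξ - lam • u i := fun i => by
    have h2 := hup i
    rw [hz i] at h2 ⊢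
    rw [h2, smul_sub, smul_add, smul_smul _ (lam / w i), mul_div_cancel₀ _ (hw i).ne']; module
  simp only [h1] at hvp
  rw [Finset.sum_sub_distrib, ← Finset.sum_smul, hwsum, one_smul, ← Finset.smul_sum,
    sub_eq_iff_eq_add, add_assoc, left_eq_add, ← smul_add] at hvp
  have h2 := (smul_eq_zero.1 hvp).resolve_left hlam.ne'
  refine ⟨Fin.snoc (α := fun _ => H) u v, fun i => ?_, ?_⟩
  · induction i using Fin.lastCases with
    | last => simpa using hv
    | cast i => simpa [hz i] using hu i
  · rw [Fin.sum_univ_castSucc]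
    simp only [Fin.snoc_castSucc, Fin.snoc_last]
    rw [add_comm, h2]

theorem exists_drMap_eq_of_mem_zerosOf (hw : ∀ i, 0 < w i) (hwsum : ∑ i, w i = 1)
    (hJ : ∀ i x, resolventOp (lam / w i) (A i.castSucc) x = {J i x})
    (hJ' : ∀ x, resolventOp lam (A (Fin.last n)) x = {J' x}) {s : H}
    (hs : s ∈ zerosOf (sumOp A)) : ∃ p, drMap w μ J J' p = p ∧ drShadow w J J' p = s := by
  obtain ⟨u, hu, hsum⟩ := hs
  -- Chosen so that the resolvent of each `A i` sends `p i` to `s`.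
  set p : ProdSpace H n := WithLp.toLp 2 fun i => s + (lam / w i) • u i.castSucc
  have hz : ∀ i, J i (p i) = s := fun i => by
    have : s ∈ resolventOp (lam / w i) (A i.castSucc) (p i) := ⟨_, hu _, rfl⟩
    rw [hJ] at this
    exact this.symm
  have hξ : drShadow w J J' p = s := by
    have h1 : ∀ i, w i • ((2 : ℝ) • J i (p i) - p i) = w i • s - lam • u i.castSucc := fun i => by
      rw [hz]
      change w i • ((2 : ℝ) • s - (s + (lam / w i) • u i.castSucc)) = _
      rw [smul_sub, smul_add, smul_smul _ (lam / w i), mul_div_cancel₀ _ (hw i).ne']; module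
    have : s ∈ resolventOp lam (A (Fin.last n)) (∑ i, w i • ((2 : ℝ) • J i (p i) - p i)) := by
      refine ⟨_, hu _, ?_⟩
      simp only [h1]
      rw [Finset.sum_sub_distrib, ← Finset.sum_smul, hwsum, one_smul, ← Finset.smul_sum]
      rw [Fin.sum_univ_castSucc] at hsum
      rw [eq_neg_of_add_eq_zero_left hsum.symm, smul_neg, sub_neg_eq_add]
    rw [hJ'] at this
    exact this.symm
  refine ⟨p, ?_, hξ⟩
  have : piMap J p = diagEmb H n s := by ext i; exact hz i
  rw [drMap, hξ, this, sub_self, smul_zero, add_zero]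

end DouglasRachford

/-! ### Convergence of the shadow sequences -/

section ShadowSequences

theorem tendsto_diagEmb {H : Type*} [NormedAddCommGroup H] {n : ℕ} {κ : Type*} {l : Filter κ} {x : κ → H}
    {a : H} (hx : Tendsto x l (𝓝 a)) : Tendsto (fun k => diagEmb H n (x k)) l (𝓝 (diagEmb H n a)) :=
  ((PiLp.continuous_toLp 2 _).comp (continuous_pi fun _ => continuous_id)).tendsto a |>.comp hx

variable {H : Type*} [NormedAddCommGroup H] [InnerProductSpace ℝ H] {n : ℕ}

theorem mem_resolventOp_iff {γ : ℝ} (hγ : γ ≠ 0) {A : H → Set H} {a x : H} :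
    a ∈ resolventOp γ A x ↔ γ⁻¹ • (x - a) ∈ A a := by
  constructor
  · rintro ⟨u, hu, rfl⟩
    rwa [add_sub_cancel_left, inv_smul_smul₀ hγ]
  · intro h
    exact ⟨_, h, by rw [smul_inv_smul₀ hγ]; abel⟩

theorem norm_piMap_sub_le {J : Fin n → H → H} {L : Fin n → ℝ}
    (hL : ∀ i x y, ‖J i x - J i y‖ ≤ L i * ‖x - y‖) (p q : ProdSpace H n) :
    ‖piMap J p - piMap J q‖ ≤ √(∑ i, L i ^ 2) * ‖p - q‖ := by
  refine le_trans (le_of_sq_le_sq ?_ (norm_nonneg _)) (norm_weightMap_le L (p - q))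
  rw [PiLp.norm_sq_eq_of_L2, PiLp.norm_sq_eq_of_L2]
  refine Finset.sum_le_sum fun i _ => ?_
  rw [weightMap_apply, norm_smul, Real.norm_eq_abs]
  refine pow_le_pow_left₀ (norm_nonneg _) ((hL i _ _).trans ?_) 2
  exact mul_le_mul_of_nonneg_right (le_abs_self _) (norm_nonneg _)

theorem tendsto_inner_apply {κ : Type*} {l : Filter κ} {x : κ → ProdSpace H n} {a : ProdSpace H n}
    (hx : ∀ v, Tendsto (fun k => (inner ℝ (x k) v : ℝ)) l (𝓝 (inner ℝ a v))) (i : Fin n) (v : H) :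
    Tendsto (fun k => (inner ℝ (x k i) v : ℝ)) l (𝓝 (inner ℝ (a i) v)) := by
  have h := hx (weightMap H (fun j => if j = i then 1 else 0) (diagEmb H n v))
  simpa only [PiLp.inner_apply, weightMap_apply, diagEmb_apply, inner_smul_right, ite_mul, one_mul,
    zero_mul, Finset.sum_ite_eq', Finset.mem_univ, if_true] using h

theorem tendsto_inner_diagEmb {κ : Type*} {l : Filter κ} {x : κ → H} {a : H}
    (hx : ∀ v, Tendsto (fun k => (inner ℝ (x k) v : ℝ)) l (𝓝 (inner ℝ a v)))
    (v : ProdSpace H n) : Tendsto (fun k => (inner ℝ (diagEmb H n (x k)) v : ℝ)) l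
      (𝓝 (inner ℝ (diagEmb H n a) v)) := by
  simp only [PiLp.inner_apply, diagEmb_apply]
  exact tendsto_finsetSum _ fun i _ => hx (v i)

theorem tendsto_one_div_sqrt_nat : Tendsto (fun k : ℕ => 1 / √(k : ℝ)) atTop (𝓝 0) := by
  simp only [one_div]
  exact (Real.tendsto_sqrt_atTop.comp tendsto_natCast_atTop_atTop).inv_tendsto_atTop

theorem isLittleO_one_div_sqrt_succ {F : Type*} [NormedAddCommGroup F] {f : ℕ → F}
    (hf : f =o[atTop] fun k : ℕ => 1 / √(k : ℝ)) :
    (fun k => f (k + 1)) =o[atTop] fun k : ℕ => 1 / √(k : ℝ) := by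
  refine (hf.comp_tendsto (tendsto_add_atTop_nat 1)).trans_isBigO (IsBigO.of_bound 1 ?_)
  filter_upwards [eventually_gt_atTop 0] with k hk
  have hk' : (0 : ℝ) < k := by exact_mod_cast hk
  simp only [Function.comp_apply, Real.norm_eq_abs, one_mul, abs_of_nonneg, one_div_nonneg,
    Real.sqrt_nonneg]
  refine one_div_le_one_div_of_le (Real.sqrt_pos.2 hk') (Real.sqrt_le_sqrt ?_)
  push_cast; linarith

variable {A : Fin (n + 1) → H → Set H} {w : Fin n → ℝ} {lam μ : ℝ}
  {J : Fin n → H → H} {J' : H → H}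

/-- Resolvents need not be weakly continuous, so the limit cannot be taken inside `J'`. Instead, any
weak cluster point `ζ` of the shadows is also one of every `J i (x k i)`, and demiclosedness for the
whole family shows that `ζ` is the resolvent of `A i` at `a i`, that is, the shadow of `a`. -/
theorem tendsto_inner_drShadow [CompleteSpace H] (hA : ∀ i, IsMaximalSigmaMonotone 0 (A i))
    (hw : ∀ i, 0 < w i) (hwsum : ∑ i, w i = 1) (hlam : 0 < lam) (hμ : μ ≠ 0)
    (hJ : ∀ i x, resolventOp (lam / w i) (A i.castSucc) x = {J i x})
    (hJ' : ∀ x, J' x ∈ resolventOp lam (A (Fin.last n)) x)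
    {x : ℕ → ProdSpace H n} {a : ProdSpace H n} {M N : ℝ} (ha : drMap w μ J J' a = a)
    (hx : ∀ v, Tendsto (fun k => (inner ℝ (x k) v : ℝ)) atTop (𝓝 (inner ℝ a v)))
    (hM : ∀ k, ‖drShadow w J J' (x k)‖ ≤ M) (hN : ∀ k, ‖x k - piMap J (x k)‖ ≤ N)
    (hres : Tendsto (fun k => diagEmb H n (drShadow w J J' (x k)) - piMap J (x k)) atTop (𝓝 0))
    (v : H) : Tendsto (fun k => (inner ℝ (drShadow w J J' (x k)) v : ℝ)) atTop
      (𝓝 (inner ℝ (drShadow w J J' a) v)) := by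
  set ξ : ℕ → H := fun k => drShadow w J J' (x k) with hξ
  rw [tendsto_iff_ultrafilter]
  intro U hU
  obtain ⟨ζ, hζ⟩ := exists_tendsto_inner_of_bounded U hM
  suffices h : ζ = drShadow w J J' a by rw [← h]; exact hζ v
  have hd : ∀ i, Tendsto (fun k => J i (x k i) - ξ k) U (𝓝 0) := fun i => by
    have h := (tendsto_norm_zero.comp (hres.mono_left hU))
    refine squeeze_zero_norm (fun k => ?_) h
    rw [norm_sub_rev]
    exact PiLp.norm_apply_le (diagEmb H n (ξ k) - piMap J (x k)) i
  have hz : ∀ i v, Tendsto (fun k => (inner ℝ (J i (x k i)) v : ℝ)) U (𝓝 (inner ℝ ζ v)) :=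
    fun i => tendsto_inner_of_tendsto_sub hζ (hd i)
  have hxi := tendsto_inner_apply fun v => (hx v).mono_left hU
  set u : ℕ → Fin n → H := fun k i => (lam / w i)⁻¹ • (x k i - J i (x k i)) with hu
  set v : ℕ → H := fun k => lam⁻¹ • (∑ i, w i • ((2 : ℝ) • J i (x k i) - x k i) - ξ k) with hv
  set η : Fin n → H := fun i => (lam / w i)⁻¹ • (a i - ζ) with hη
  set η' : H := lam⁻¹ • (∑ i, w i • ((2 : ℝ) • ζ - a i) - ζ) with hη'
  -- The operator values `v` and `u` add up to a combination of the gaps `b i - e`: strongly null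
  -- along the iteration, zero at the weak limit.
  have hsum : ∀ (c b : Fin n → H) (e : H),
      lam⁻¹ • (∑ i, w i • ((2 : ℝ) • b i - c i) - e) + ∑ i, (lam / w i)⁻¹ • (c i - b i) =
        ∑ i, (lam⁻¹ * w i) • (b i - e) := by
    intro c b e
    have h1 : e = ∑ i, w i • e := by rw [← Finset.sum_smul, hwsum, one_smul]
    nth_rewrite 1 [h1]
    rw [← Finset.sum_sub_distrib, Finset.smul_sum, ← Finset.sum_add_distrib]
    refine Finset.sum_congr rfl fun i _ => ?_
    rw [inv_div, div_eq_inv_mul]; module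
  have hBu : ∀ k i, ‖u k i‖ ≤ ‖(lam / w i)⁻¹‖ * N := fun k i => by
    rw [hu, norm_smul]
    exact mul_le_mul_of_nonneg_left
      ((PiLp.norm_apply_le (x k - piMap J (x k)) i).trans (hN k)) (norm_nonneg _)
  have hmem : ∀ i : Fin (n + 1), (Fin.snoc (α := fun _ => H) η η' : Fin (n + 1) → H) i ∈
      A i ((fun _ => ζ) i) := by
    refine mem_of_tendsto_inner_of_tendsto_sum_inner (l := (U : Filter ℕ)) hA
      (z := fun k => Fin.snoc (α := fun _ => H) (fun i => J i (x k i)) (ξ k))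
      (u := fun k => Fin.snoc (α := fun _ => H) (u k) (v k)) (fun k i => ?_) (fun i b => ?_)
      (fun i b => ?_) ?_
    · induction i using Fin.lastCases with
      | last =>
        simp only [Fin.snoc_last]
        exact (mem_resolventOp_iff hlam.ne').1 (hJ' _)
      | cast i =>
        simp only [Fin.snoc_castSucc]
        exact (mem_resolventOp_iff (div_pos hlam (hw i)).ne').1 (by rw [hJ]; rfl)
    · induction i using Fin.lastCases with
      | last => simpa using hζ b
      | cast i => simpa using hz i b
    · induction i using Fin.lastCases with
      | last =>
        simp only [Fin.snoc_last, hv, hη', inner_smul_left, inner_sub_left, sum_inner]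
        exact ((tendsto_finsetSum _ fun i _ =>
          (((hz i b).const_mul _).sub (hxi i b)).const_mul _).sub (hζ b)).const_mul _
      | cast i =>
        simp only [Fin.snoc_castSucc, hu, hη, inner_smul_left, inner_sub_left]
        exact ((hxi i b).sub (hz i b)).const_mul _
    · simp only [Fin.sum_univ_castSucc, Fin.snoc_castSucc, Fin.snoc_last]
      have h1 : ∑ i, inner ℝ ζ (η i) + inner ℝ ζ η' = (0 : ℝ) := by
        rw [← inner_sum, ← inner_add_right, add_comm, hη', hη, hsum a.ofLp (fun _ => ζ) ζ]
        simp
      -- Each term on the right pairs a strongly null sequence with a bounded one, although the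
      -- products on the left pair merely weakly convergent sequences.
      have h2 : ∀ k, ∑ i, inner ℝ (J i (x k i)) (u k i) + inner ℝ (ξ k) (v k) =
          ∑ i, (inner ℝ (J i (x k i) - ξ k) (u k i) : ℝ) +
            inner ℝ (∑ i, (lam⁻¹ * w i) • (J i (x k i) - ξ k)) (ξ k) := by
        intro k
        rw [← hsum (x k).ofLp (fun i => J i (x k i)) (ξ k), real_inner_comm (ξ k)]
        simp only [inner_sub_left, Finset.sum_sub_distrib, inner_add_right, ← inner_sum]
        ring
      rw [h1]
      simp only [h2]
      have h3 := (tendsto_finsetSum Finset.univ fun i _ =>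
        tendsto_inner_zero_of_bounded (hd i) fun k => hBu k i)
      have h4 : Tendsto (fun k => ∑ i, (lam⁻¹ * w i) • (J i (x k i) - ξ k)) U (𝓝 0) := by
        simpa using tendsto_finsetSum Finset.univ fun i _ => (hd i).const_smul (lam⁻¹ * w i)
      simpa using h3.add (tendsto_inner_zero_of_bounded h4 hM)
  obtain ⟨i⟩ : Nonempty (Fin n) := by
    by_contra h
    rw [not_nonempty_iff] at h
    simp at hwsum
  have h1 := hmem i.castSucc
  simp only [Fin.snoc_castSucc, hη] at h1
  have h2 := (mem_resolventOp_iff (div_pos hlam (hw i)).ne').2 h1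
  rw [hJ] at h2
  rw [show ζ = J i (a i) from h2]
  exact congrArg (fun f : ProdSpace H n => f i) (piMap_eq_of_drMap_eq hμ ha)

end ShadowSequences

end

/-! ### The main theorem -/

theorem mainTheorem1 {H : Type*} [NormedAddCommGroup H] [InnerProductSpace ℝ H] [CompleteSpace H]
    (n : ℕ) (A : Fin (n + 1) → H → Set H) (σ : Fin (n + 1) → ℝ)
    (hA : ∀ i, IsMaximalSigmaMonotone (σ i) (A i))
    (hzer : (zerosOf (sumOp A)).Nonempty)
    (μ : ℝ) (hμ : μ ∈ Set.Ioo (0 : ℝ) 2)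
    (w : Fin n → ℝ) (hw : ∀ i, 0 < w i) (hwsum : ∑ i, w i = 1)
    (lamBar : EReal)
    (hcase : (NonmonotoneCase σ ∧ lamBar = optimalStep σ w μ) ∨ (MonotoneCase σ ∧ lamBar = ⊤))
    (lam : ℝ) (hlam0 : 0 < lam) (hlam : (lam : EReal) < lamBar) :
    -- the maps of the algorithm are single-valued with full domain
    ∃ (JF JG T : ProdSpace H n → ProdSpace H n) (U : ProdSpace H n → H),
      (∀ p, resF A w lam p = {JF p}) ∧ (∀ p, resG A w lam p = {JG p}) ∧
      (∀ p, drOp A w lam μ p = {T p}) ∧ (∀ p, opU A w lam p = {U p}) ∧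
      ∀ x z y : ℕ → ProdSpace H n, IsDRSequence A w lam μ x z y →
        ∃ xbar ∈ fixOf (drOp A w lam μ),
          -- weak convergence to a fixed point, which yields a zero
          WeaklyConverges x xbar ∧
          JF xbar ∈ diagEmb H n '' zerosOf (sumOp A) ∧
          -- rate of the fixed-point residual
          ((fun k => ‖x k - T (x k)‖) =o[atTop] fun k : ℕ => 1 / √(k : ℝ)) ∧
          -- rates of the successive differences
          ((fun k => ‖y (k + 1) - y k‖) =o[atTop] fun k : ℕ => 1 / √(k : ℝ)) ∧
          ((fun k => ‖z (k + 1) - z k‖) =o[atTop] fun k : ℕ => 1 / √(k : ℝ)) ∧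
          -- strong convergence of the shadow sequences to the unique zero
          (NonmonotoneCase σ ∨ (MonotoneCase σ ∧ ∃ j, 0 < σ j) →
            Tendsto z atTop (𝓝 (JF xbar)) ∧ Tendsto y atTop (𝓝 (JF xbar)) ∧
            zerosOf (sumOp A) = {U xbar}) ∧
          -- weak convergence of the shadow sequences when all moduli vanish
          (MonotoneCase σ ∧ (∀ i, σ i = 0) →
            WeaklyConverges z (JF xbar) ∧ WeaklyConverges y (JF xbar)) := by
  have hμ0 : μ ≠ 0 := hμ.1.ne'
  obtain ⟨α, hαsum, hα, hstrong⟩ := exists_splitting hμ hw hwsum hcase hlam0 hlam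
  obtain ⟨hpos, hpos'⟩ := resolvent_moduli_pos hμ hw hwsum hαsum hlam0 hα
  have hγ : ∀ i, 0 < lam / w i := fun i => div_pos hlam0 (hw i)
  choose J hJ using fun i : Fin n => (hA i.castSucc).exists_resolventOp_eq (hγ i) (hpos i)
  obtain ⟨J', hJ'⟩ := (hA (Fin.last n)).exists_resolventOp_eq hlam0 hpos'
  have hJmem : ∀ i x, J i x ∈ resolventOp (lam / w i) (A i.castSucc) x := fun i x => by
    rw [hJ]; rfl
  have hJ'mem : ∀ x, J' x ∈ resolventOp lam (A (Fin.last n)) x := fun x => by rw [hJ']; rfl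
  have hF : ∀ p, resF A w lam p = {piMap J p} := fun p => by
    ext z
    rw [mem_resF_iff hw]
    simp only [hJ, Set.mem_singleton_iff]
    exact ⟨fun h => by ext i; exact h i, fun h i => by rw [h]; rfl⟩
  have hG : ∀ q, resG A w lam q = {diagEmb H n (J' (∑ i, w i • q i))} := fun q => by
    ext y
    rw [mem_resG_iff hlam0 hwsum]
    simp [hJ']
  have hT : ∀ p, drOp A w lam μ p = {drMap w μ J J' p} := fun p => by
    ext t
    simp only [drOp, hF, hG, Set.mem_singleton_iff, exists_eq_left]
    rfl
  have hU : ∀ p, opU A w lam p = {drShadow w J J' p} := fun p => by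
    ext t
    simp only [opU, reflectedResolventOp, hJ, hJ', Set.mem_singleton_iff, exists_eq_left]
    constructor
    · rintro ⟨r, hr, rfl⟩
      rw [show r = fun i => (2 : ℝ) • J i (p i) - p i from funext hr]
      rfl
    · rintro rfl
      exact ⟨_, fun i => rfl, rfl⟩
  obtain ⟨ε, hε, hquad⟩ := exists_pos_mul_le_sum_quadratic hμ hw hαsum hlam0 hα H
  set T := drMap w μ J J'
  set ξ := drShadow w J J'
  have hstep := sum_mul_norm_drMap_sub_sq_le (fun i => (hA i).prop) hw hwsum hlam0 hμ.1 hJmem hJ'mem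
  have hTsub : ∀ p, p - T p = -(μ • (diagEmb H n (ξ p) - piMap J p)) := fun p => by
    simp only [T, drMap]; abel
  -- A residual is `μ` times a shadow gap, up to sign, so its square carries `μ²` against the factor
  -- `μ * ε` of the decrease; hence `ε / μ`. The bound `w i ≤ 1` passes from unweighted to weighted
  -- gaps.
  have havg : ∀ p q, ∑ i, w i * ‖(T p - T q) i‖ ^ 2 ≤ ∑ i, w i * ‖(p - q) i‖ ^ 2 -
      ε / μ * ∑ i, w i * ‖((p - T p) - (q - T q)) i‖ ^ 2 := by
    intro p q
    refine (hstep p q).trans (sub_le_sub_left ?_ _)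
    have h1 := mul_le_mul_of_nonneg_left (hquad (ξ p - ξ q) fun i => J i (p i) - J i (q i)).1 hμ.1.le
    refine le_trans ?_ h1
    have h2 : ∀ i, ‖((p - T p) - (q - T q)) i‖ ^ 2 =
        μ ^ 2 * ‖(ξ p - ξ q) - (J i (p i) - J i (q i))‖ ^ 2 := fun i => by
      rw [hTsub, hTsub, ← norm_neg, ← sq_abs μ, ← Real.norm_eq_abs, ← mul_pow, ← norm_smul]
      congr 2
      simp only [PiLp.sub_apply, PiLp.neg_apply, PiLp.smul_apply, diagEmb_apply, piMap]
      module
    simp only [h2]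
    rw [Finset.mul_sum, Finset.mul_sum, Finset.mul_sum]
    refine Finset.sum_le_sum fun i _ => ?_
    have h3 : w i ≤ 1 := hwsum ▸ Finset.single_le_sum (fun j _ => (hw j).le) (Finset.mem_univ i)
    set d := ‖(ξ p - ξ q) - (J i (p i) - J i (q i))‖ ^ 2
    have h4 : ε / μ * (w i * (μ ^ 2 * d)) = w i * (μ * (ε * d)) := by field_simp
    rw [h4]
    exact mul_le_of_le_one_left (mul_nonneg hμ.1.le (mul_nonneg hε.le (sq_nonneg _))) h3
  obtain ⟨s, hszer⟩ := hzer
  obtain ⟨p, hp, -⟩ := exists_drMap_eq_of_mem_zerosOf (μ := μ) hw hwsum hJ hJ' hszer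
  refine ⟨piMap J, fun q => diagEmb H n (J' (∑ i, w i • q i)), T, ξ, hF, hG, hT, hU, ?_⟩
  intro x z y hseq
  have hz : z = fun k => piMap J (x k) := funext fun k => by
    have := (hseq k).1
    rwa [hF] at this
  have hy : y = fun k => diagEmb H n (ξ (x k)) := funext fun k => by
    have := (hseq k).2.1
    rw [hG, hz] at this
    exact this
  have hx : ∀ k, x (k + 1) = T (x k) := fun k => by
    rw [(hseq k).2.2, hz, hy]; rfl
  obtain ⟨⟨a, ha, hweak⟩, ⟨M, hM⟩, hrate⟩ :=
    weighted_averaged_iteration hw (div_pos hε hμ.1) havg hp hx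
  have hza : piMap J a = diagEmb H n (ξ a) := piMap_eq_of_drMap_eq hμ0 ha
  have hξa : ξ a ∈ zerosOf (sumOp A) := drShadow_mem_zerosOf hw hwsum hlam0 hμ0 hJmem hJ'mem ha
  have hLip : ∀ i x y, ‖J i x - J i y‖ ≤ (1 + lam / w i * σ i.castSucc)⁻¹ * ‖x - y‖ :=
    fun i x y => (hA i.castSucc).prop.norm_sub_le_of_mem_resolventOp (hγ i) (hpos i)
      (hJmem i x) (hJmem i y)
  have hzLip := norm_piMap_sub_le hLip
  have hrate' : (fun k => x (k + 1) - x k) =o[atTop] fun k : ℕ => 1 / √(k : ℝ) :=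
    (hrate.congr_left fun k => by rw [hx, norm_sub_rev]).of_norm_left
  have hzrate : (fun k => z (k + 1) - z k) =o[atTop] fun k : ℕ => 1 / √(k : ℝ) := by
    refine IsBigO.trans_isLittleO (IsBigO.of_bound
      (√(∑ i : Fin n, (1 + lam / w i * σ i.castSucc)⁻¹ ^ 2)) (Eventually.of_forall fun k => ?_)) hrate'
    rw [hz]; exact hzLip _ _
  -- This reduces the rate for `y` to those for `z` and `x`.
  have hyeq : ∀ k, y k = z k + μ⁻¹ • (x (k + 1) - x k) := fun k => by
    rw [(hseq k).2.2, add_sub_cancel_left, inv_smul_smul₀ hμ0, add_sub_cancel]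
  have hyrate : (fun k => y (k + 1) - y k) =o[atTop] fun k : ℕ => 1 / √(k : ℝ) := by
    have h := hzrate.add (((isLittleO_one_div_sqrt_succ hrate').sub hrate').const_smul_left μ⁻¹)
    refine h.congr_left fun k => ?_
    simp only [Pi.smul_apply, hyeq, smul_sub]
    abel
  have hyz : Tendsto (fun k => y k - z k) atTop (𝓝 0) := by
    have h := (hrate'.trans_tendsto tendsto_one_div_sqrt_nat).const_smul μ⁻¹
    rw [smul_zero] at h
    exact h.congr fun k => by rw [hyeq, add_sub_cancel_left]
  refine ⟨a, by rw [fixOf, Set.mem_ofPred_eq, hT, ha]; rfl, hweak, ⟨ξ a, hξa, hza.symm⟩, hrate,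
    hyrate.norm_left, hzrate.norm_left, fun hst => ?_, fun hzero => ?_⟩
  · have hst' := hstrong hst
    -- For two fixed points the right side vanishes, so their shadows coincide; as every zero is
    -- such a shadow, the zero is unique. Along the iterates, with `q' = a`, it is the decrement of
    -- a convergent sequence.
    have hcontr : ∀ q q', μ * (ε * ‖ξ q - ξ q'‖ ^ 2) ≤
        ∑ i, w i * ‖(q - q') i‖ ^ 2 - ∑ i, w i * ‖(T q - T q') i‖ ^ 2 := fun q q' => by
      have h1 := hstep q q'
      have h2 := mul_le_mul_of_nonneg_left
        ((hquad (ξ q - ξ q') fun i => J i (q i) - J i (q' i)).2 hst') hμ.1.le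
      linarith
    have huniq : zerosOf (sumOp A) = {ξ a} := by
      refine Set.eq_singleton_iff_unique_mem.2 ⟨hξa, fun t ht => ?_⟩
      obtain ⟨q, hq, rfl⟩ := exists_drMap_eq_of_mem_zerosOf (μ := μ) hw hwsum hJ hJ' ht
      have h1 := hcontr q a
      rw [ha, show T q = q from hq, sub_self] at h1
      have h2 : ‖ξ q - ξ a‖ ^ 2 ≤ 0 := by
        have : 0 < μ * ε := mul_pos hμ.1 hε
        by_contra! h3
        nlinarith
      exact sub_eq_zero.1 (norm_eq_zero.1 (pow_eq_zero_iff two_ne_zero |>.1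
        (le_antisymm h2 (sq_nonneg _))))
    have hξlim : Tendsto (fun k => ξ (x k)) atTop (𝓝 (ξ a)) := by
      set W : ℕ → ℝ := fun k => ∑ i, w i * ‖(x k - a) i‖ ^ 2
      have hW : ∀ k, μ * (ε * ‖ξ (x k) - ξ a‖ ^ 2) ≤ W k - W (k + 1) := fun k => by
        have := hcontr (x k) a
        rwa [ha, ← hx] at this
      have hWanti : Antitone W := antitone_nat_of_succ_le fun k => by
        have h1 := hW k
        have h2 : 0 ≤ μ * (ε * ‖ξ (x k) - ξ a‖ ^ 2) :=
          mul_nonneg hμ.1.le (mul_nonneg hε.le (sq_nonneg _))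
        linarith
      have hWlim := tendsto_atTop_ciInf hWanti ⟨0, by
        rintro _ ⟨k, rfl⟩
        exact Finset.sum_nonneg fun i _ => mul_nonneg (hw i).le (sq_nonneg _)⟩
      have hWdiff := hWlim.sub (hWlim.comp (tendsto_add_atTop_nat 1))
      rw [sub_self] at hWdiff
      have h1 := squeeze_zero (fun k => mul_nonneg hμ.1.le (mul_nonneg hε.le (sq_nonneg _))) hW hWdiff
      have h2 := ((h1.const_mul μ⁻¹).const_mul ε⁻¹).sqrt
      simp only [inv_mul_cancel_left₀ hμ0, inv_mul_cancel_left₀ hε.ne', mul_zero, Real.sqrt_zero,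
        Real.sqrt_sq (norm_nonneg _)] at h2
      exact tendsto_iff_norm_sub_tendsto_zero.2 h2
    have hylim : Tendsto y atTop (𝓝 (piMap J a)) := by
      rw [hy, hza]; exact tendsto_diagEmb hξlim
    refine ⟨?_, hylim, huniq⟩
    have := hylim.sub hyz
    rw [sub_zero] at this
    exact this.congr fun k => sub_sub_cancel _ _
  · have hA0 : ∀ i, IsMaximalSigmaMonotone 0 (A i) := fun i => hzero.2 i ▸ hA i
    obtain ⟨B, hB⟩ : ∃ B, ∀ k, ‖piMap J (x k)‖ ≤ B := by
      refine ⟨√(∑ i : Fin n, (1 + lam / w i * σ i.castSucc)⁻¹ ^ 2) * (M + ‖a‖) + ‖piMap J a‖,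
        fun k => ?_⟩
      have h1 := hzLip (x k) a
      have h2 : ‖x k - a‖ ≤ M + ‖a‖ := (norm_sub_le _ _).trans (add_le_add_left (hM k) _)
      have h3 := norm_le_norm_sub_add (piMap J (x k)) (piMap J a)
      have h4 := mul_le_mul_of_nonneg_left h2
        (Real.sqrt_nonneg (∑ i : Fin n, (1 + lam / w i * σ i.castSucc)⁻¹ ^ 2))
      linarith
    obtain ⟨C, hC⟩ := hyz.norm.bddAbove_range
    obtain ⟨i⟩ : Nonempty (Fin n) := by
      by_contra h
      rw [not_nonempty_iff] at h
      simp at hwsum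
    have hξB : ∀ k, ‖ξ (x k)‖ ≤ C + B := fun k => by
      have h1 : ‖ξ (x k)‖ ≤ ‖y k‖ := by
        rw [hy]; exact PiLp.norm_apply_le (diagEmb H n (ξ (x k))) i
      have h2 := norm_le_norm_sub_add (y k) (z k)
      have h3 : ‖y k - z k‖ ≤ C := hC ⟨k, rfl⟩
      have h4 : ‖z k‖ ≤ B := by rw [hz]; exact hB k
      linarith
    have hξweak := tendsto_inner_drShadow hA0 hw hwsum hlam0 hμ0 hJ hJ'mem ha
      (weaklyConverges_iff_forall_inner.1 hweak) hξB
      (fun k => (norm_sub_le _ _).trans (add_le_add (hM k) (hB k))) (by rwa [hy, hz] at hyz)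
    have hyweak : ∀ v, Tendsto (fun k => (inner ℝ (y k) v : ℝ)) atTop
        (𝓝 (inner ℝ (piMap J a) v)) := by
      rw [hy, hza]; exact tendsto_inner_diagEmb hξweak
    have hzy : Tendsto (fun k => z k - y k) atTop (𝓝 0) := by
      simpa using hyz.neg
    exact ⟨weaklyConverges_iff_forall_inner.2 (tendsto_inner_of_tendsto_sub hyweak hzy),
      weaklyConverges_iff_forall_inner.2 hyweak⟩
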